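/- \textbf{Conventions.} Let $d\ge 3$, let $U\subset\mathbb{R}^d$ be a bounded open set with Lebesgue measure $|U|$, and let $C_0^\infty(U)$ be the smooth functions with compact support in $U$. $H^{1,2}(U)$ is the space of $u\in L^2(U)$ whose weak gradient $\nabla u$ lies in $L^2(U,\mathbb{R}^d)$, and $H^{1,2}_0(U)$ is the closure of $C_0^\infty(U)$ in $H^{1,2}(U)$. Let $\hat A=(\hat a_{ij})_{1\le i,j\le d}$ be a (possibly non-symmetric) matrix of measurable functions on $U$ for which there are constants $\lambda>0$ and $M>0$ with $$\langle \hat A(x)\xi,\xi\rangle\ge\lambda\|\xi\|^2,\qquad \max_{i,j}|\hat a_{ij}(x)|\le M\qquad\text{for a.e. }x\in U\text{ and all }\xi\in\mathbb{R}^d.$$ Let $\hat{\mathbf B}\in L^2(U,\mathbb{R}^d)$ satisfy $\int_U\langle\hat{\mathbf B},\nabla\varphi\rangle\,dx\ge 0$ for all $\varphi\in C_0^\infty(U)$ with $\varphi\ge 0$, and let $\hat c\in L^1(U)$ with $\hat c\ge 0$ a.e. in $U$. For $\hat f\in L^1(U)$, a \emph{weak solution} of $$-\mathrm{div}(\hat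 A\nabla\hat u)+\langle\hat{\mathbf B},\nabla\hat u\rangle+\hat c\hat u=\hat f\ \text{ in }U,\qquad \hat u=0\ \text{ on }\partial U \qquad (*)$$ is a function $\hat u\in H^{1,2}_0(U)$ with $\hat c\hat u\in L^1(U)$ and $$\int_U\langle\hat A\nabla\hat u,\nabla\varphi\rangle\,dx+\int_U\langle\hat{\mathbf B},\nabla\hat u\rangle\varphi\,dx+\int_U\hat c\hat u\varphi\,dx=\int_U\hat f\varphi\,dx\qquad\text{for all }\varphi\in C_0^\infty(U).$$ \textbf{Theorem.} (i) If $\hat v\in H^{1,2}_0(U)$ satisfies $\hat c\hat v\in L^1(U)$ and $$\int_U\langle\hat A\nabla\hat v,\nabla\varphi\rangle\,dx+\int_U\langle\hat{\mathbf B},\nabla\hat v\rangle\varphi\,dx+\int_U\hat c\hat v\varphi\,dx=0\qquad\text{for all }\varphi\in C_0^\infty(U),$$ then $\hat v=0$ a.e. in $U$. (ii) If $\hat f\in L^{\frac{\hat pd}{d+\hat p}}(U)$ for some $\hat p\in(d,\infty)$, then there exists a unique weak solution $\hat u$ of $(*)$. Moreover $\hat u\in L^\infty(U)$ and $$\|\nabla\hat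 u\|_{L^2(U)}\le\hat C_1\|\hat f\|_{L^{\frac{2d}{d+2}}(U)},\qquad \|\hat u\|_{L^\infty(U)}\le\hat C_2\|\hat f\|_{L^{\frac{\hat pd}{d+\hat p}}(U)},$$ where $\hat C_1>0$ depends only on $d$ and $\lambda$, and $\hat C_2>0$ depends only on $\lambda$, $d$, $\hat p$ and $|U|$. -/

import Mathlib

open MeasureTheory TopologicalSpace
open scoped Distributions ENNReal NNReal

namespace EllipticDirichlet

/-- The Euclidean space `ℝ^d`. -/
abbrev Space (d : ℕ) : Type := EuclideanSpace ℝ (Fin d)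

/-- Lebesgue measure on `Ω`. -/
noncomputable abbrev vol {d : ℕ} (Ω : Opens (Space d)) : Measure (Space d) :=
  volume.restrict (Ω : Set (Space d))

/-- `G = (∂₁u, …, ∂_d u)` is the weak gradient of `u` on `Ω`. Here `𝓓(Ω, ℝ)` is Mathlib's space of
smooth functions with compact support contained in `Ω`. -/
structure HasWeakGradient {d : ℕ} (Ω : Opens (Space d)) (u : Space d → ℝ)
    (G : Space d → Space d) : Prop where
  locallyIntegrable : LocallyIntegrableOn u (Ω : Set (Space d))
  locallyIntegrable_grad : LocallyIntegrableOn G (Ω : Set (Space d))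
  integral_eq : ∀ (φ : 𝓓(Ω, ℝ)) (i : Fin d),
    ∫ x, u x * gradient φ x i ∂(vol Ω) = -∫ x, G x i * φ x ∂(vol Ω)

open Classical in
/-- The weak gradient of `u` on `Ω`, unique up to null sets in `Ω` when it exists
(and `0` by convention otherwise). -/
noncomputable def weakGradient {d : ℕ} (Ω : Opens (Space d)) (u : Space d → ℝ) :
    Space d → Space d :=
  if h : ∃ G, HasWeakGradient Ω u G then h.choose else 0

theorem weakGradient_spec {d : ℕ} {Ω : Opens (Space d)} {u : Space d → ℝ}
    {G : Space d → Space d} (h : HasWeakGradient Ω u G) :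
    HasWeakGradient Ω u (weakGradient Ω u) := by
  have h' : ∃ G, HasWeakGradient Ω u G := ⟨G, h⟩
  unfold weakGradient
  rw [dif_pos h']
  exact h'.choose_spec

/-- `u` belongs to the Sobolev space `H^{1,2}(Ω)`. -/
structure MemH12 {d : ℕ} (Ω : Opens (Space d)) (u : Space d → ℝ) : Prop where
  hasWeakGradient : ∃ G, HasWeakGradient Ω u G
  memLp : MemLp u 2 (vol Ω)
  memLp_grad : MemLp (weakGradient Ω u) 2 (vol Ω)

/-- `u` belongs to `H^{1,2}_0(Ω)`, the closure of `C_0^∞(Ω)` in `H^{1,2}(Ω)`. -/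
structure MemH120 {d : ℕ} (Ω : Opens (Space d)) (u : Space d → ℝ) : Prop where
  memH12 : MemH12 Ω u
  approx : ∀ ε : ℝ≥0∞, 0 < ε → ∃ φ : 𝓓(Ω, ℝ),
    eLpNorm (fun x => u x - φ x) 2 (vol Ω) ≤ ε ∧
    eLpNorm (fun x => weakGradient Ω u x - gradient φ x) 2 (vol Ω) ≤ ε

/-- `A` is a matrix of measurable functions on `Ω`, uniformly strictly elliptic with constant `lam`
and with entries bounded by `M`. -/
structure UniformlyElliptic {d : ℕ} (Ω : Opens (Space d))
    (A : Space d → Matrix (Fin d) (Fin d) ℝ) (lam M : ℝ) : Prop where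
  measurable : ∀ i j, AEStronglyMeasurable (fun x => A x i j) (vol Ω)
  elliptic : ∀ᵐ x ∂(vol Ω), ∀ ξ : Space d, lam * ‖ξ‖ ^ 2 ≤ inner ℝ ((A x).toEuclideanLin ξ) ξ
  bounded : ∀ᵐ x ∂(vol Ω), ∀ i j, |A x i j| ≤ M

/-- The weak divergence of `B` on `Ω` is nonpositive. -/
def WeakDivNonpos {d : ℕ} (Ω : Opens (Space d)) (B : Space d → Space d) : Prop :=
  ∀ φ : 𝓓(Ω, ℝ), (∀ x, 0 ≤ φ x) → 0 ≤ ∫ x, inner ℝ (B x) (gradient φ x) ∂(vol Ω)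

/-- `u` is a weak solution of `-div(A∇u) + ⟨B, ∇u⟩ + c u = f` in `Ω`, `u = 0` on `∂Ω`. -/
structure IsWeakSolution {d : ℕ} (Ω : Opens (Space d))
    (A : Space d → Matrix (Fin d) (Fin d) ℝ) (B : Space d → Space d) (c f u : Space d → ℝ) :
    Prop where
  memH120 : MemH120 Ω u
  integrable_mul : Integrable (fun x => c x * u x) (vol Ω)
  integral_eq : ∀ φ : 𝓓(Ω, ℝ),
    ∫ x, inner ℝ ((A x).toEuclideanLin (weakGradient Ω u x)) (gradient φ x) ∂(vol Ω)
      + ∫ x, inner ℝ (B x) (weakGradient Ω u x) * φ x ∂(vol Ω)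
      + ∫ x, c x * u x * φ x ∂(vol Ω) = ∫ x, f x * φ x ∂(vol Ω)

end EllipticDirichlet

open EllipticDirichlet

/-! ### Test functions and weak gradients. -/

namespace EllipticDirichlet

open Filter
open scoped Topology ContDiff

variable {d : ℕ} {Ω : Opens (Space d)}

/-! Since `B` is only in `L²` and `c` only in `L¹`, the equation can be tested only with bounded
functions. The sign conditions make the lower-order terms harmless. Let `T` be bounded, smooth and
nondecreasing with `T 0 = 0`, and let `Φ` be its antiderivative vanishing at `0`. Then `T(u)∇u =
∇Φ(u)` with `Φ ≥ 0`, so the drift term is nonnegative by the divergence condition, and `c u T(u) ≥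
0` because `t T(t) ≥ 0`. Ellipticity then gives `λ ∫ T'(u)|∇u|² ≤ ∫ f T(u)`
(`IsWeakSolution.energy_le`).

The sup bound is Stampacchia's argument. Take `S` rising in absolute value from `0` on `|t| ≤ k` to
`1` on `|t| ≥ h`, and choose `T' = (S')²`. The left side becomes `λ‖∇S(u)‖²`, which Sobolev's
inequality bounds below by a multiple of `‖S(u)‖²` in the critical norm. Hölder's inequality on
`{|u| > k}` bounds the right side. This relates the measures of `{|u| > h}` and `{|u| > k}` with a
power greater than one exactly because `p > d` (`IsWeakSolution.level_le`), and iteration over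
levels makes some superlevel set null (`eq_zero_of_iteration`). Taking `f = 0` gives uniqueness.

For existence the bilinear form is not bounded on `H^{1,2}_0`, so Lax–Milgram does not apply
directly. Lions' variant (`exists_inner_eq_of_coercive`) needs coercivity only on test functions.
There the drift contributes `∫ ⟨B, ∇(φ²/2)⟩ ≥ 0`, and the zeroth-order term enters the Hilbert space
through the weight `√(c/λ)`. The norm bound on the abstract solution is the gradient estimate. -/

theorem norm_gradient (u : Space d → ℝ) (x : Space d) : ‖gradient u x‖ = ‖fderiv ℝ u x‖ := by
  simp [gradient]

theorem gradient_apply (u : Space d → ℝ) (x : Space d) (i : Fin d) :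
    gradient u x i = fderiv ℝ u x (EuclideanSpace.single i 1) := by
  have h : inner ℝ (gradient u x) (EuclideanSpace.single i (1 : ℝ))
      = fderiv ℝ u x (EuclideanSpace.single i 1) := by
    simp only [gradient, InnerProductSpace.toDual_symm_apply]
  rw [← h, EuclideanSpace.inner_single_right]
  simp

theorem hasGradientAt_test (φ : 𝓓(Ω, ℝ)) (x : Space d) : HasGradientAt φ (gradient φ x) x :=
  ((φ.contDiff.differentiable (by simp)) x).hasGradientAt

theorem continuous_gradient (φ : 𝓓(Ω, ℝ)) : Continuous (gradient φ) :=
  (InnerProductSpace.toDual ℝ (Space d)).symm.continuous.comp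
    (φ.contDiff.continuous_fderiv (by simp))

theorem gradient_eq_zero_of_notMem_tsupport {u : Space d → ℝ} {x : Space d} (hx : x ∉ tsupport u) :
    gradient u x = 0 := by
  rw [← norm_eq_zero, norm_gradient, fderiv_of_notMem_tsupport ℝ hx, norm_zero]

theorem hasCompactSupport_gradient (φ : 𝓓(Ω, ℝ)) : HasCompactSupport (gradient φ) :=
  HasCompactSupport.intro φ.hasCompactSupport fun _ hx => gradient_eq_zero_of_notMem_tsupport hx

theorem memLp_test (φ : 𝓓(Ω, ℝ)) (p : ℝ≥0∞) : MemLp φ p (vol Ω) :=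
  (φ.continuous.memLp_of_hasCompactSupport φ.hasCompactSupport).restrict _

theorem memLp_gradient_test (φ : 𝓓(Ω, ℝ)) (p : ℝ≥0∞) : MemLp (gradient φ) p (vol Ω) :=
  ((continuous_gradient φ).memLp_of_hasCompactSupport (hasCompactSupport_gradient φ)).restrict _

/-- Composition of a test function with a smooth function vanishing at `0`. -/
noncomputable def compTest (S : ℝ → ℝ) (hS : ContDiff ℝ ∞ S) (h0 : S 0 = 0) (φ : 𝓓(Ω, ℝ)) : 𝓓(Ω, ℝ) where
  toFun := S ∘ φ
  contDiff' := hS.comp φ.contDiff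
  hasCompactSupport' := φ.hasCompactSupport.comp_left h0
  tsupport_subset' := (tsupport_comp_subset h0 φ).trans φ.tsupport_subset

theorem compTest_apply {S : ℝ → ℝ} (hS : ContDiff ℝ ∞ S) (h0 : S 0 = 0) (φ : 𝓓(Ω, ℝ))
    (x : Space d) : compTest S hS h0 φ x = S (φ x) := rfl

theorem gradient_compTest {S s : ℝ → ℝ} (hS : ContDiff ℝ ∞ S) (h0 : S 0 = 0)
    (hs : ∀ t, HasDerivAt S (s t) t) (φ : 𝓓(Ω, ℝ)) (x : Space d) :
    gradient (compTest S hS h0 φ) x = s (φ x) • gradient φ x := by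
  apply HasGradientAt.gradient
  rw [hasGradientAt_iff_hasFDerivAt]
  have h := (hs (φ x)).comp_hasFDerivAt x (hasGradientAt_test φ x).hasFDerivAt
  have e : InnerProductSpace.toDual ℝ (Space d) (s (φ x) • gradient φ x)
      = s (φ x) • InnerProductSpace.toDual ℝ (Space d) (gradient φ x) := by simp
  rw [e]
  exact h

theorem gradient_add_test (φ ψ : 𝓓(Ω, ℝ)) (x : Space d) :
    gradient (φ + ψ : 𝓓(Ω, ℝ)) x = gradient φ x + gradient ψ x := by
  apply HasGradientAt.gradient
  rw [hasGradientAt_iff_hasFDerivAt]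
  simpa using (hasGradientAt_test φ x).hasFDerivAt.add (hasGradientAt_test ψ x).hasFDerivAt

theorem gradient_smul_test (a : ℝ) (φ : 𝓓(Ω, ℝ)) (x : Space d) :
    gradient (a • φ : 𝓓(Ω, ℝ)) x = a • gradient φ x := by
  apply HasGradientAt.gradient
  rw [hasGradientAt_iff_hasFDerivAt]
  simpa using (hasGradientAt_test φ x).hasFDerivAt.const_smul a

theorem gradient_sub_test (φ ψ : 𝓓(Ω, ℝ)) (x : Space d) :
    gradient (φ - ψ : 𝓓(Ω, ℝ)) x = gradient φ x - gradient ψ x := by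
  apply HasGradientAt.gradient
  rw [hasGradientAt_iff_hasFDerivAt]
  simpa using (hasGradientAt_test φ x).hasFDerivAt.sub (hasGradientAt_test ψ x).hasFDerivAt

theorem integral_mul_gradient_test (φ ψ : 𝓓(Ω, ℝ)) (i : Fin d) :
    ∫ x, φ x * gradient ψ x i ∂(vol Ω) = -∫ x, gradient φ x i * ψ x ∂(vol Ω) := by
  have hz : ∀ x ∉ (Ω : Set (Space d)), ∀ χ : 𝓓(Ω, ℝ), χ x = 0 := fun x hx χ =>
    image_eq_zero_of_notMem_tsupport fun h => hx (χ.tsupport_subset h)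
  rw [setIntegral_eq_integral_of_forall_compl_eq_zero (fun x hx => by rw [hz x hx φ, zero_mul]),
    setIntegral_eq_integral_of_forall_compl_eq_zero (fun x hx => by rw [hz x hx ψ, mul_zero])]
  simp_rw [gradient_apply]
  have cφ := φ.contDiff.continuous_fderiv (by simp)
  have cψ := ψ.contDiff.continuous_fderiv (by simp)
  have := φ.continuous
  have := ψ.continuous
  apply integral_mul_fderiv_eq_neg_fderiv_mul_of_integrable
  · exact Continuous.integrable_of_hasCompactSupport (by fun_prop) ψ.hasCompactSupport.mul_left
  · exact Continuous.integrable_of_hasCompactSupport (by fun_prop) φ.hasCompactSupport.mul_right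
  · exact Continuous.integrable_of_hasCompactSupport (by fun_prop) ψ.hasCompactSupport.mul_left
  · exact fun x _ => φ.contDiff.differentiable (by simp) x
  · exact fun x _ => ψ.contDiff.differentiable (by simp) x

theorem integrable_mul_of_locallyIntegrableOn {u : Space d → ℝ}
    (hu : LocallyIntegrableOn u (Ω : Set (Space d))) {g : Space d → ℝ} (hg : Continuous g)
    {K : Set (Space d)} (hK : IsCompact K) (hKΩ : K ⊆ Ω) (hgK : ∀ x ∉ K, g x = 0) :
    Integrable (fun x => u x * g x) (vol Ω) := by
  have h1 : IntegrableOn (fun x => u x * g x) K :=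
    (hu.integrableOn_compact_subset hKΩ hK).mul_continuousOn hg.continuousOn hK
  refine ((integrableOn_iff_integrable_of_support_subset ?_).1 h1).restrict
  intro x hx
  by_contra h
  exact hx (by simp [hgK x h])

theorem HasWeakGradient.integrable_mul_gradient {u : Space d → ℝ} {G : Space d → Space d}
    (h : HasWeakGradient Ω u G) (φ : 𝓓(Ω, ℝ)) (i : Fin d) :
    Integrable (fun x => u x * gradient φ x i) (vol Ω) :=
  integrable_mul_of_locallyIntegrableOn h.locallyIntegrable (by have := continuous_gradient φ; fun_prop)
    φ.hasCompactSupport φ.tsupport_subset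
    fun x hx => by rw [gradient_eq_zero_of_notMem_tsupport hx]; rfl

theorem locallyIntegrableOn_coord {G : Space d → Space d}
    (h : LocallyIntegrableOn G (Ω : Set (Space d))) (i : Fin d) :
    LocallyIntegrableOn (fun x => G x i) (Ω : Set (Space d)) := fun x hx => by
  obtain ⟨t, ht, hi⟩ := h x hx
  exact ⟨t, ht, (EuclideanSpace.proj i : Space d →L[ℝ] ℝ).integrable_comp hi⟩

theorem HasWeakGradient.integrable_mul {u : Space d → ℝ} {G : Space d → Space d}
    (h : HasWeakGradient Ω u G) (φ : 𝓓(Ω, ℝ)) (i : Fin d) :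
    Integrable (fun x => G x i * φ x) (vol Ω) :=
  integrable_mul_of_locallyIntegrableOn (locallyIntegrableOn_coord h.locallyIntegrable_grad i) φ.continuous
    φ.hasCompactSupport φ.tsupport_subset fun _ hx => image_eq_zero_of_notMem_tsupport hx

/-- The fundamental lemma of the calculus of variations, coordinate by coordinate. It lets any
explicitly found gradient replace the chosen `weakGradient`. -/
theorem HasWeakGradient.ae_eq {u : Space d → ℝ} {G₁ G₂ : Space d → Space d}
    (h₁ : HasWeakGradient Ω u G₁) (h₂ : HasWeakGradient Ω u G₂) : G₁ =ᵐ[vol Ω] G₂ := by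
  have key : ∀ i : Fin d, ∀ᵐ x ∂(vol Ω), G₁ x i - G₂ x i = 0 := by
    intro i
    rw [ae_restrict_iff' Ω.isOpen.measurableSet]
    refine Ω.isOpen.ae_eq_zero_of_integral_contDiff_smul_eq_zero
      ((locallyIntegrableOn_coord h₁.locallyIntegrable_grad i).sub
        (locallyIntegrableOn_coord h₂.locallyIntegrable_grad i)) ?_
    intro g hg hgc hgs
    let φ : 𝓓(Ω, ℝ) := ⟨g, hg, hgc, hgs⟩
    have e : ∫ x, G₁ x i * φ x ∂(vol Ω) = ∫ x, G₂ x i * φ x ∂(vol Ω) := by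
      have e₁ := h₁.integral_eq φ i
      rw [h₂.integral_eq φ i] at e₁
      linarith
    rw [← setIntegral_eq_integral_of_forall_compl_eq_zero (s := (Ω : Set (Space d)))]
    · have : ∀ x, g x • (G₁ x i - G₂ x i) = G₁ x i * φ x - G₂ x i * φ x := fun x => by
        change g x * _ = _ * g x - _ * g x
        ring
      change ∫ x, g x • (G₁ x i - G₂ x i) ∂(vol Ω) = 0
      simp_rw [this]
      rw [integral_sub (h₁.integrable_mul φ i) (h₂.integrable_mul φ i), e, sub_self]
    · intro x hx
      rw [image_eq_zero_of_notMem_tsupport fun h => hx (hgs h), zero_smul]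
  filter_upwards [ae_all_iff.2 key] with x hx
  ext i
  exact sub_eq_zero.1 (hx i)

theorem HasWeakGradient.sub {u v : Space d → ℝ} {G H : Space d → Space d}
    (hu : HasWeakGradient Ω u G) (hv : HasWeakGradient Ω v H) :
    HasWeakGradient Ω (fun x => u x - v x) (fun x => G x - H x) where
  locallyIntegrable := hu.locallyIntegrable.sub hv.locallyIntegrable
  locallyIntegrable_grad := hu.locallyIntegrable_grad.sub hv.locallyIntegrable_grad
  integral_eq φ i := by
    simp only [PiLp.sub_apply, sub_mul]
    rw [integral_sub (hu.integrable_mul_gradient φ i) (hv.integrable_mul_gradient φ i),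
      integral_sub (hu.integrable_mul φ i) (hv.integrable_mul φ i), hu.integral_eq,
      hv.integral_eq]
    ring

theorem memLp_locallyIntegrableOn_vol {E : Type*} [NormedAddCommGroup E] {g : Space d → E}
    (h : MemLp g 2 (vol Ω)) : LocallyIntegrableOn g (Ω : Set (Space d)) :=
  locallyIntegrableOn_of_locallyIntegrable_restrict (h.locallyIntegrable (by norm_num))

end EllipticDirichlet

/-! ### Limits in `L²` and the space `H^{1,2}_0`. -/

namespace EllipticDirichlet

open Filter
open scoped Topology

section L2

variable {α E : Type*} [MeasurableSpace α] {μ : Measure α} [NormedAddCommGroup E]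
  [InnerProductSpace ℝ E]

theorem inner_toLp_toLp {X G : α → E} (hX : MemLp X 2 μ) (hG : MemLp G 2 μ) :
    inner ℝ (hX.toLp X) (hG.toLp G) = ∫ x, inner ℝ (X x) (G x) ∂μ := by
  rw [L2.inner_def]
  apply integral_congr_ae
  filter_upwards [hX.coeFn_toLp, hG.coeFn_toLp] with x h₁ h₂
  rw [h₁, h₂]

theorem tendsto_integral_inner {X G : α → E} {Gn : ℕ → α → E} (hX : MemLp X 2 μ)
    (hG : MemLp G 2 μ) (hGn : ∀ n, MemLp (Gn n) 2 μ)
    (h : Tendsto (fun n => eLpNorm (fun x => Gn n x - G x) 2 μ) atTop (𝓝 0)) :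
    Tendsto (fun n => ∫ x, inner ℝ (X x) (Gn n x) ∂μ) atTop (𝓝 (∫ x, inner ℝ (X x) (G x) ∂μ)) := by
  simp_rw [← inner_toLp_toLp hX hG, ← fun n => inner_toLp_toLp hX (hGn n)]
  refine Tendsto.inner tendsto_const_nhds ?_
  exact (Lp.tendsto_Lp_iff_tendsto_eLpNorm'' Gn hGn G hG).2 h

/-- Dominated convergence for the squared norms, with `|2K G|²` as majorant. -/
theorem tendsto_eLpNorm_sub_mul_of_bounded {g : α → ℝ} {gn : ℕ → α → ℝ} {G : α → E} {K : ℝ}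
    (hgm : ∀ n, AEStronglyMeasurable (gn n) μ) (hK : ∀ n x, |gn n x| ≤ K)
    (hg : ∀ᵐ x ∂μ, Tendsto (fun n => gn n x) atTop (𝓝 (g x))) (hG : MemLp G 2 μ) :
    Tendsto (fun n => eLpNorm (fun x => (gn n x - g x) • G x) 2 μ) atTop (𝓝 0) := by
  have hgm' : AEStronglyMeasurable g μ := aestronglyMeasurable_of_tendsto_ae _ hgm hg
  have hbd : ∀ᵐ x ∂μ, |g x| ≤ K := by
    filter_upwards [hg] with x hx
    exact le_of_tendsto hx.abs (Eventually.of_forall fun n => hK n x)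
  have e : ∀ n, eLpNorm (fun x => (gn n x - g x) • G x) 2 μ
      = (∫⁻ x, ‖(gn n x - g x) • G x‖ₑ ^ (2 : ℝ) ∂μ) ^ (1 / (2 : ℝ)) := fun n => by
    rw [eLpNorm_eq_lintegral_rpow_enorm_toReal (by norm_num) (by norm_num)]
    norm_num
  simp_rw [e]
  have hfin : ∫⁻ x, ‖(2 * K) • G x‖ₑ ^ (2 : ℝ) ∂μ ≠ ∞ := by
    have := (hG.const_smul (2 * K)).eLpNorm_lt_top
    have h2 := lintegral_rpow_enorm_lt_top_of_eLpNorm_lt_top (by norm_num) (by norm_num) this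
    exact ne_of_lt (by simpa using h2)
  have key : Tendsto (fun n => ∫⁻ x, ‖(gn n x - g x) • G x‖ₑ ^ (2 : ℝ) ∂μ) atTop
      (𝓝 (∫⁻ _, 0 ∂μ)) := by
    refine tendsto_lintegral_of_dominated_convergence' _ ?_ ?_ hfin ?_
    · exact fun n => ((((hgm n).sub hgm').smul hG.1).enorm).pow_const _
    · intro n
      filter_upwards [hbd] with x hx
      gcongr
      rw [enorm_le_iff_norm_le, norm_smul, norm_smul]
      gcongr
      have := abs_sub (gn n x) (g x)
      have := hK n x
      have := le_abs_self (2 * K)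
      rw [Real.norm_eq_abs, Real.norm_eq_abs]
      linarith
    · filter_upwards [hg] with x hx
      have h1 : Tendsto (fun n => ‖(gn n x - g x) • G x‖ₑ ^ (2 : ℝ)) atTop
          (𝓝 (‖(g x - g x) • G x‖ₑ ^ (2 : ℝ))) :=
        (((hx.sub_const _).smul_const _).enorm).ennrpow_const _
      simpa using h1
  have := key.ennrpow_const (1 / (2 : ℝ))
  simpa using this

/-- Split the difference as `gₙ(Gₙ - G) + (gₙ - g)G`. This replaces a chain rule in `H^{1,2}_0`: it
gives the `L²` limit of the gradients of smooth functions of approximating test functions. -/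
theorem tendsto_eLpNorm_sub_smul {g : α → ℝ} {gn : ℕ → α → ℝ} {G : α → E} {Gn : ℕ → α → E} {K : ℝ}
    (hgm : ∀ n, AEStronglyMeasurable (gn n) μ) (hK : ∀ n x, |gn n x| ≤ K)
    (hg : ∀ᵐ x ∂μ, Tendsto (fun n => gn n x) atTop (𝓝 (g x)))
    (hG : MemLp G 2 μ) (hGn : ∀ n, MemLp (Gn n) 2 μ)
    (h : Tendsto (fun n => eLpNorm (fun x => Gn n x - G x) 2 μ) atTop (𝓝 0)) :
    Tendsto (fun n => eLpNorm (fun x => gn n x • Gn n x - g x • G x) 2 μ) atTop (𝓝 0) := by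
  have hgm' : AEStronglyMeasurable g μ := aestronglyMeasurable_of_tendsto_ae _ hgm hg
  have h1 : Tendsto (fun n => ENNReal.ofReal K * eLpNorm (fun x => Gn n x - G x) 2 μ
      + eLpNorm (fun x => (gn n x - g x) • G x) 2 μ) atTop (𝓝 0) := by
    have h2 := tendsto_eLpNorm_sub_mul_of_bounded hgm hK hg hG
    have h3 := (ENNReal.Tendsto.const_mul (a := ENNReal.ofReal K) h (Or.inr (by simp))).add h2
    simpa using h3
  refine tendsto_of_tendsto_of_tendsto_of_le_of_le tendsto_const_nhds h1 (fun _ => zero_le) ?_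
  intro n
  have e : (fun x => gn n x • Gn n x - g x • G x)
      = (fun x => gn n x • (Gn n x - G x)) + fun x => (gn n x - g x) • G x := by
    ext x
    simp only [Pi.add_apply, smul_sub, sub_smul]
    abel
  beta_reduce
  rw [e]
  refine (eLpNorm_add_le ((hgm n).smul ((hGn n).1.sub hG.1)) (((hgm n).sub hgm').smul hG.1)
    (by norm_num)).trans (add_le_add ?_ le_rfl)
  refine eLpNorm_le_mul_eLpNorm_of_ae_le_mul (Eventually.of_forall fun x => ?_) 2
  change ‖gn n x • (Gn n x - G x)‖ ≤ _
  rw [norm_smul]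
  gcongr
  exact hK n x

theorem memLp_smul_of_bounded {g : α → ℝ} {G : α → E} {K : ℝ} (hgm : AEStronglyMeasurable g μ)
    (hK : ∀ᵐ x ∂μ, |g x| ≤ K) (hG : MemLp G 2 μ) : MemLp (fun x => g x • G x) 2 μ :=
  MemLp.of_le_mul hG (hgm.smul hG.1) (c := K) (by
    filter_upwards [hK] with x hx
    rw [norm_smul]
    gcongr
    exact hx)

theorem integrable_inner {X G : α → E} (hX : MemLp X 2 μ) (hG : MemLp G 2 μ) :
    Integrable (fun x => inner ℝ (X x) (G x)) μ := by
  refine (L2.integrable_inner (𝕜 := ℝ) (hX.toLp X) (hG.toLp G)).congr ?_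
  filter_upwards [hX.coeFn_toLp, hG.coeFn_toLp] with x h₁ h₂
  rw [h₁, h₂]

end L2

variable {d : ℕ} {Ω : Opens (Space d)}

theorem memLp_coord {G : Space d → Space d} (hG : MemLp G 2 (vol Ω)) (i : Fin d) :
    MemLp (fun x => G x i) 2 (vol Ω) :=
  (EuclideanSpace.proj i : Space d →L[ℝ] ℝ).comp_memLp' hG

/-- Both sides of the integration by parts formula are `L²` pairings against a fixed function, hence
continuous under the two convergences. -/
theorem hasWeakGradient_of_tendsto {u : Space d → ℝ} {G : Space d → Space d} {φ : ℕ → 𝓓(Ω, ℝ)}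
    (hu : MemLp u 2 (vol Ω)) (hG : MemLp G 2 (vol Ω))
    (h : Tendsto (fun n => eLpNorm (fun x => φ n x - u x) 2 (vol Ω)) atTop (𝓝 0))
    (h' : Tendsto (fun n => eLpNorm (fun x => gradient (φ n) x - G x) 2 (vol Ω)) atTop (𝓝 0)) :
    HasWeakGradient Ω u G where
  locallyIntegrable := memLp_locallyIntegrableOn_vol hu
  locallyIntegrable_grad := memLp_locallyIntegrableOn_vol hG
  integral_eq ψ i := by
    have h1 := tendsto_integral_inner (memLp_coord (memLp_gradient_test ψ 2) i) hu
      (fun n => memLp_test (φ n) 2) h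
    have h2c : Tendsto (fun n => eLpNorm (fun x => gradient (φ n) x i - G x i) 2 (vol Ω)) atTop
        (𝓝 0) := by
      refine tendsto_of_tendsto_of_tendsto_of_le_of_le tendsto_const_nhds h' (fun _ => zero_le) ?_
      exact fun n => eLpNorm_mono fun x => PiLp.norm_apply_le (gradient (φ n) x - G x) i
    have h2 := tendsto_integral_inner (memLp_test ψ 2) (memLp_coord hG i)
      (fun n => memLp_coord (memLp_gradient_test (φ n) 2) i) h2c
    simp only [RCLike.inner_apply, conj_trivial] at h1 h2
    refine tendsto_nhds_unique h1 ?_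
    simp_rw [integral_mul_gradient_test]
    exact h2.neg

theorem MemH120.exists_seq {u : Space d → ℝ} (hu : MemH120 Ω u) : ∃ φ : ℕ → 𝓓(Ω, ℝ),
    Tendsto (fun n => eLpNorm (fun x => φ n x - u x) 2 (vol Ω)) atTop (𝓝 0) ∧
    Tendsto (fun n => eLpNorm (fun x => gradient (φ n) x - weakGradient Ω u x) 2 (vol Ω)) atTop
      (𝓝 0) ∧
    ∀ᵐ x ∂(vol Ω), Tendsto (fun n => φ n x) atTop (𝓝 (u x)) := by
  obtain ⟨ε, -, hε0, hε⟩ := exists_seq_strictAnti_tendsto' (show (0 : ℝ≥0∞) < 1 by simp)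
  choose φ h1 h2 using fun n => hu.approx (ε n) (hε0 n).1
  have t1 : Tendsto (fun n => eLpNorm (fun x => φ n x - u x) 2 (vol Ω)) atTop (𝓝 0) := by
    refine tendsto_of_tendsto_of_tendsto_of_le_of_le tendsto_const_nhds hε (fun _ => zero_le) ?_
    intro n
    refine le_trans (le_of_eq ?_) (h1 n)
    exact eLpNorm_congr_norm_ae (Eventually.of_forall fun x => norm_sub_rev _ _)
  have t2 : Tendsto (fun n => eLpNorm (fun x => gradient (φ n) x - weakGradient Ω u x) 2 (vol Ω))
      atTop (𝓝 0) := by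
    refine tendsto_of_tendsto_of_tendsto_of_le_of_le tendsto_const_nhds hε (fun _ => zero_le) ?_
    intro n
    refine le_trans (le_of_eq ?_) (h2 n)
    exact eLpNorm_congr_norm_ae (Eventually.of_forall fun x => norm_sub_rev _ _)
  have tm : TendstoInMeasure (vol Ω) (fun n => (φ n : Space d → ℝ)) atTop u :=
    tendstoInMeasure_of_tendsto_eLpNorm (by norm_num) (fun n => (memLp_test (φ n) 2).1)
      hu.memH12.memLp.1 t1
  obtain ⟨ns, hns, hae⟩ := tm.exists_seq_tendsto_ae
  exact ⟨φ ∘ ns, t1.comp hns.tendsto_atTop, t2.comp hns.tendsto_atTop, hae⟩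

theorem memH120_of_tendsto {u : Space d → ℝ} {G : Space d → Space d} {φ : ℕ → 𝓓(Ω, ℝ)}
    (hu : MemLp u 2 (vol Ω)) (hG : MemLp G 2 (vol Ω))
    (h : Tendsto (fun n => eLpNorm (fun x => φ n x - u x) 2 (vol Ω)) atTop (𝓝 0))
    (h' : Tendsto (fun n => eLpNorm (fun x => gradient (φ n) x - G x) 2 (vol Ω)) atTop (𝓝 0)) :
    MemH120 Ω u := by
  have hw := hasWeakGradient_of_tendsto hu hG h h'
  have hae := (weakGradient_spec hw).ae_eq hw
  refine ⟨⟨⟨G, hw⟩, hu, (memLp_congr_ae hae).2 hG⟩, fun ε hε => ?_⟩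
  obtain ⟨n, h1, h2⟩ := ((h.eventually_le_const hε).and (h'.eventually_le_const hε)).exists
  refine ⟨φ n, ?_, ?_⟩
  · refine le_trans (le_of_eq ?_) h1
    exact eLpNorm_congr_norm_ae (Eventually.of_forall fun x => norm_sub_rev _ _)
  · refine le_trans (le_of_eq ?_) h2
    apply eLpNorm_congr_norm_ae
    filter_upwards [hae] with x hx
    rw [hx, norm_sub_rev]

theorem MemH120.hasWeakGradient {u : Space d → ℝ} (hu : MemH120 Ω u) :
    HasWeakGradient Ω u (weakGradient Ω u) :=
  weakGradient_spec hu.memH12.hasWeakGradient.choose_spec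

theorem MemH120.weakGradient_sub_ae {u v : Space d → ℝ} (hu : MemH120 Ω u) (hv : MemH120 Ω v) :
    weakGradient Ω (fun x => u x - v x) =ᵐ[vol Ω] fun x => weakGradient Ω u x - weakGradient Ω v x :=
  (weakGradient_spec (hu.hasWeakGradient.sub hv.hasWeakGradient)).ae_eq
    (hu.hasWeakGradient.sub hv.hasWeakGradient)

theorem MemH120.sub {u v : Space d → ℝ} (hu : MemH120 Ω u) (hv : MemH120 Ω v) :
    MemH120 Ω (fun x => u x - v x) := by
  obtain ⟨φ, h1, h2, -⟩ := hu.exists_seq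
  obtain ⟨ψ, h3, h4, -⟩ := hv.exists_seq
  have e1 : ∀ n, eLpNorm (fun x => (φ n - ψ n : 𝓓(Ω, ℝ)) x - (u x - v x)) 2 (vol Ω)
      ≤ eLpNorm (fun x => φ n x - u x) 2 (vol Ω) + eLpNorm (fun x => ψ n x - v x) 2 (vol Ω) := by
    intro n
    have e : (fun x => (φ n - ψ n : 𝓓(Ω, ℝ)) x - (u x - v x))
        = (fun x => φ n x - u x) - fun x => ψ n x - v x := by
      ext x
      simp only [FunLike.coe_sub, Pi.sub_apply]
      ring
    rw [e]
    exact eLpNorm_sub_le ((memLp_test (φ n) 2).1.sub hu.memH12.memLp.1)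
      ((memLp_test (ψ n) 2).1.sub hv.memH12.memLp.1) (by norm_num)
  have e2 : ∀ n, eLpNorm (fun x => gradient (φ n - ψ n : 𝓓(Ω, ℝ)) x
        - (weakGradient Ω u x - weakGradient Ω v x)) 2 (vol Ω)
      ≤ eLpNorm (fun x => gradient (φ n) x - weakGradient Ω u x) 2 (vol Ω)
        + eLpNorm (fun x => gradient (ψ n) x - weakGradient Ω v x) 2 (vol Ω) := by
    intro n
    have e : (fun x => gradient (φ n - ψ n : 𝓓(Ω, ℝ)) x
          - (weakGradient Ω u x - weakGradient Ω v x))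
        = (fun x => gradient (φ n) x - weakGradient Ω u x)
          - fun x => gradient (ψ n) x - weakGradient Ω v x := by
      ext1 x
      simp only [gradient_sub_test, Pi.sub_apply]
      abel
    rw [e]
    exact eLpNorm_sub_le ((memLp_gradient_test (φ n) 2).1.sub hu.memH12.memLp_grad.1)
      ((memLp_gradient_test (ψ n) 2).1.sub hv.memH12.memLp_grad.1) (by norm_num)
  have t1 := h1.add h3
  have t2 := h2.add h4
  rw [add_zero] at t1 t2
  exact memH120_of_tendsto (φ := fun n => φ n - ψ n)
    (G := fun x => weakGradient Ω u x - weakGradient Ω v x)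
    (hu.memH12.memLp.sub hv.memH12.memLp) (hu.memH12.memLp_grad.sub hv.memH12.memLp_grad)
    (tendsto_of_tendsto_of_tendsto_of_le_of_le tendsto_const_nhds t1 (fun _ => zero_le) e1)
    (tendsto_of_tendsto_of_tendsto_of_le_of_le tendsto_const_nhds t2 (fun _ => zero_le) e2)

end EllipticDirichlet

/-! ### Smooth truncations and the iteration lemma. -/

namespace EllipticDirichlet

open Filter
open scoped Topology

section Truncation

theorem exists_smooth_antideriv {s : ℝ → ℝ} (hs : ContDiff ℝ ((⊤ : ℕ∞) : WithTop ℕ∞) s) :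
    ∃ S : ℝ → ℝ, ContDiff ℝ ((⊤ : ℕ∞) : WithTop ℕ∞) S ∧ S 0 = 0 ∧ ∀ t, HasDerivAt S (s t) t := by
  have h : ∀ t, HasDerivAt (fun t => ∫ x in (0 : ℝ)..t, s x) (s t) t := fun t =>
    intervalIntegral.integral_hasDerivAt_right (hs.continuous.intervalIntegrable _ _)
      hs.continuous.aestronglyMeasurable.stronglyMeasurableAtFilter hs.continuous.continuousAt
  refine ⟨fun t => ∫ x in (0 : ℝ)..t, s x, ?_, by simp, h⟩
  rw [contDiff_infty_iff_deriv]
  refine ⟨fun t => (h t).differentiableAt, ?_⟩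
  rwa [show deriv (fun t => ∫ x in (0 : ℝ)..t, s x) = s from funext fun t => (h t).deriv]

/-- Both `T` and `L S - T` are nondecreasing and vanish at `0`. Applied with `τ = s²` and `s ≤ L`,
it trades one factor `s` for the constant `L`. -/
theorem antideriv_abs_le {S T s τ : ℝ → ℝ} {L : ℝ} (hL : 0 ≤ L) (hS : ∀ t, HasDerivAt S (s t) t)
    (hT : ∀ t, HasDerivAt T (τ t) t) (hS0 : S 0 = 0) (hT0 : T 0 = 0) (hτ : ∀ t, 0 ≤ τ t)
    (hτs : ∀ t, τ t ≤ L * s t) (t : ℝ) : |T t| ≤ L * |S t| := by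
  have mT : Monotone T := monotone_of_hasDerivAt_nonneg (fun t => hT t) hτ
  have mD : Monotone fun t => L * S t - T t :=
    monotone_of_hasDerivAt_nonneg (fun t => ((hS t).const_mul L).sub (hT t))
      fun t => sub_nonneg.2 (hτs t)
  rcases le_total 0 t with h | h
  · have h1 := mT h
    have h2 := mD h
    simp only [hS0, hT0] at h1 h2
    rw [abs_of_nonneg h1]
    have := mul_le_mul_of_nonneg_left (le_abs_self (S t)) hL
    linarith
  · have h1 := mT h
    have h2 := mD h
    simp only [hS0, hT0] at h1 h2
    rw [abs_of_nonpos h1]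
    have := mul_le_mul_of_nonneg_left (neg_le_abs (S t)) hL
    linarith

/-- `Φ` decreases up to `0` and increases after it, so its minimum is `Φ 0 = 0`. -/
theorem antideriv_nonneg {Φ T : ℝ → ℝ} (hΦ : ∀ t, HasDerivAt Φ (T t) t) (hΦ0 : Φ 0 = 0)
    (hT : ∀ t, 0 ≤ t * T t) (t : ℝ) : 0 ≤ Φ t := by
  have hc : Continuous Φ := continuous_iff_continuousAt.2 fun t => (hΦ t).continuousAt
  rcases le_total 0 t with h | h
  · have m : MonotoneOn Φ (Set.Ici 0) := by
      refine monotoneOn_of_hasDerivWithinAt_nonneg (convex_Ici 0) hc.continuousOn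
        (fun x _ => (hΦ x).hasDerivWithinAt) fun x hx => ?_
      rw [interior_Ici] at hx
      exact nonneg_of_mul_nonneg_right (hT x) hx
    rw [← hΦ0]
    exact m (Set.mem_Ici.2 le_rfl) h h
  · have m : AntitoneOn Φ (Set.Iic 0) := by
      refine antitoneOn_of_hasDerivWithinAt_nonpos (convex_Iic 0) hc.continuousOn
        (fun x _ => (hΦ x).hasDerivWithinAt) fun x hx => ?_
      rw [interior_Iic] at hx
      by_contra hn
      exact absurd (hT x) (not_le.2 (mul_neg_of_neg_of_pos hx (not_le.1 hn)))
    rw [← hΦ0]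
    exact m h (Set.mem_Iic.2 le_rfl) h

theorem exists_deriv_smoothTransition_le : ∃ L : ℝ, 0 < L ∧
    ∀ t, deriv Real.smoothTransition t ≤ L := by
  have hc : Continuous (deriv Real.smoothTransition) :=
    (Real.smoothTransition.contDiff (n := 1)).continuous_deriv le_rfl
  have hs : HasCompactSupport (deriv Real.smoothTransition) := by
    refine HasCompactSupport.intro (isCompact_Icc (a := (0 : ℝ)) (b := 1)) fun x hx => ?_
    rw [Set.mem_Icc, not_and_or, not_le, not_le] at hx
    rcases hx with hx | hx
    · have : Real.smoothTransition =ᶠ[𝓝 x] fun _ => 0 := by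
        filter_upwards [Iio_mem_nhds hx] with y hy
        exact Real.smoothTransition.zero_of_nonpos (le_of_lt hy)
      rw [this.deriv_eq, deriv_const]
    · have : Real.smoothTransition =ᶠ[𝓝 x] fun _ => 1 := by
        filter_upwards [Ioi_mem_nhds hx] with y hy
        exact Real.smoothTransition.one_of_one_le (le_of_lt hy)
      rw [this.deriv_eq, deriv_const]
  obtain ⟨C, hC⟩ := hc.bounded_above_of_compact_support hs
  exact ⟨|C| + 1, by positivity, fun t => by
    have := (Real.le_norm_self _).trans (hC t)
    have := le_abs_self C
    linarith⟩

/-- Smooth odd truncations between the levels `k` and `h`. -/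
theorem exists_truncation : ∃ L : ℝ, 0 < L ∧ ∀ k h : ℝ, 0 ≤ k → k < h →
    ∃ S s : ℝ → ℝ, ContDiff ℝ ((⊤ : ℕ∞) : WithTop ℕ∞) S ∧ (∀ t, HasDerivAt S (s t) t) ∧
      (∀ t, 0 ≤ s t) ∧ (∀ t, s t ≤ L / (h - k)) ∧ (∀ t, |t| ≤ k → S t = 0) ∧
      (∀ t, |S t| ≤ 1) ∧ ∀ t, h ≤ |t| → |S t| = 1 := by
  obtain ⟨L, hL, hLb⟩ := exists_deriv_smoothTransition_le
  refine ⟨2 * L, by positivity, fun k h hk hkh => ?_⟩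
  set θ := Real.smoothTransition with hθ
  have hhk : 0 < h - k := sub_pos.2 hkh
  have hθd : ∀ t, HasDerivAt θ (deriv θ t) t := fun t =>
    ((Real.smoothTransition.contDiff (n := 1)).differentiable (by simp) t).hasDerivAt
  have hθn : ∀ t, 0 ≤ deriv θ t := fun t => Real.smoothTransition.monotone.deriv_nonneg
  have e1 : ∀ {t}, t ≤ k → θ ((t - k) / (h - k)) = 0 := fun {t} ht =>
    Real.smoothTransition.zero_of_nonpos (div_nonpos_of_nonpos_of_nonneg (by linarith) hhk.le)
  have e2 : ∀ {t}, h ≤ t → θ ((t - k) / (h - k)) = 1 := fun {t} ht =>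
    Real.smoothTransition.one_of_one_le ((one_le_div hhk).2 (by linarith))
  -- The truncation is an odd difference of two rescaled smooth steps. As `k ≥ 0`, at most one of
  -- them is nonzero at any point; bounding both derivatives separately costs the factor `2` in `2 *
  -- L`.
  refine ⟨fun t => θ ((t - k) / (h - k)) - θ ((-t - k) / (h - k)),
    fun t => deriv θ ((t - k) / (h - k)) * (1 / (h - k))
      - deriv θ ((-t - k) / (h - k)) * (-1 / (h - k)), ?_, ?_, ?_, ?_, ?_, ?_, ?_⟩
  · exact (Real.smoothTransition.contDiff.comp (by fun_prop)).sub
      (Real.smoothTransition.contDiff.comp (by fun_prop))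
  · intro t
    have d1 : HasDerivAt (fun t => (t - k) / (h - k)) (1 / (h - k)) t :=
      ((hasDerivAt_id t).sub_const k).div_const _
    have d2 : HasDerivAt (fun t => (-t - k) / (h - k)) (-1 / (h - k)) t :=
      ((hasDerivAt_id t).neg.sub_const k).div_const _
    exact ((hθd _).comp t d1).sub ((hθd _).comp t d2)
  · intro t
    have h1 := mul_nonneg (hθn ((t - k) / (h - k))) (one_div_pos.2 hhk).le
    have h2 := mul_nonneg (hθn ((-t - k) / (h - k))) (one_div_pos.2 hhk).le
    rw [neg_div]
    linarith
  · intro t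
    have h1 := mul_le_mul_of_nonneg_right (hLb ((t - k) / (h - k))) (one_div_pos.2 hhk).le
    have h2 := mul_le_mul_of_nonneg_right (hLb ((-t - k) / (h - k))) (one_div_pos.2 hhk).le
    rw [neg_div, show 2 * L / (h - k) = L * (1 / (h - k)) + L * (1 / (h - k)) by ring]
    linarith
  · intro t ht
    rw [abs_le] at ht
    simp only [e1 ht.2, e1 (show -t ≤ k by linarith), sub_self]
  · intro t
    have a1 := Real.smoothTransition.nonneg ((t - k) / (h - k))
    have a2 := Real.smoothTransition.le_one ((t - k) / (h - k))
    have a3 := Real.smoothTransition.nonneg ((-t - k) / (h - k))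
    have a4 := Real.smoothTransition.le_one ((-t - k) / (h - k))
    rw [abs_le]
    constructor <;> simp only [hθ] <;> linarith
  · intro t ht
    rcases le_abs.1 ht with h1 | h1
    · simp only [e2 h1, e1 (show -t ≤ k by linarith)]
      norm_num
    · simp only [e2 h1, e1 (show t ≤ k by linarith)]
      norm_num

/-- Stampacchia's iteration lemma. -/
theorem eq_zero_of_iteration {y : ℝ → ℝ} {β N Y : ℝ} (hβ : 1 < β) (hN : 0 < N) (hY : 0 < Y)
    (hy : ∀ k, 0 ≤ y k) (hanti : Antitone y) (hy0 : y 0 ≤ Y)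
    (h : ∀ k h, 0 ≤ k → k < h → (h - k) * y h ≤ N * y k ^ β) :
    y (N * (Y ^ (β - 1) * 2 ^ (β / (β - 1)))) = 0 := by
  set D := N * (Y ^ (β - 1) * 2 ^ (β / (β - 1))) with hD
  have hDpos : 0 < D := by positivity
  have hβ' : β - 1 ≠ 0 := by linarith
  set r : ℝ := 2 ^ (-(1 / (β - 1))) with hr
  have hrpos : 0 < r := by positivity
  have hr1 : r < 1 := Real.rpow_lt_one_of_one_lt_of_neg one_lt_two
    (neg_neg_of_pos (one_div_pos.2 (by linarith)))
  -- The levels `D(1 - 2⁻ⁿ)` increase to `D` while `y` decays geometrically along them.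
  have key : ∀ n : ℕ, y (D * (1 - (1 / 2) ^ n)) ≤ Y * r ^ n := by
    intro n
    induction n with
    | zero => simpa using hy0
    | succ n ih =>
      have hpow : (0 : ℝ) < (1 / 2) ^ n := by positivity
      have hle : ((1 : ℝ) / 2) ^ n ≤ 1 := pow_le_one₀ (by norm_num) (by norm_num)
      have step := h (D * (1 - (1 / 2) ^ n)) (D * (1 - (1 / 2) ^ (n + 1)))
        (mul_nonneg hDpos.le (by linarith))
        (mul_lt_mul_of_pos_left (by rw [pow_succ]; linarith) hDpos)
      have e : D * (1 - (1 / 2) ^ (n + 1)) - D * (1 - (1 / 2) ^ n) = D * (1 / 2) ^ (n + 1) := by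
        rw [pow_succ]; ring
      rw [e] at step
      have h2 : y (D * (1 - (1 / 2) ^ n)) ^ β ≤ (Y * r ^ n) ^ β :=
        Real.rpow_le_rpow (hy _) ih (by linarith)
      -- The values of `r` and `D` are those for which the induction step closes with equality: `r ^
      -- (β - 1) = 1/2`, and `D` absorbs the remaining constants.
      have h3 : N * (Y * r ^ n) ^ β = D * (1 / 2) ^ (n + 1) * (Y * r ^ (n + 1)) := by
        have p1 : ∀ m : ℕ, r ^ m = (2 : ℝ) ^ (-(1 / (β - 1)) * m) := fun m => by
          rw [hr, Real.rpow_mul (by norm_num), Real.rpow_natCast]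
        have p2 : ((1 : ℝ) / 2) ^ (n + 1) = (2 : ℝ) ^ (-((n + 1 : ℕ) : ℝ)) := by
          rw [Real.rpow_neg (by norm_num), Real.rpow_natCast, one_div, inv_pow]
        have p3 : (2 : ℝ) ^ (-(1 / (β - 1)) * n * β) = 2 ^ (β / (β - 1))
            * 2 ^ (-((n + 1 : ℕ) : ℝ)) * 2 ^ (-(1 / (β - 1)) * ((n + 1 : ℕ) : ℝ)) := by
          rw [← Real.rpow_add (by norm_num), ← Real.rpow_add (by norm_num)]
          congr 1
          push_cast
          field_simp
          ring
        rw [Real.mul_rpow hY.le (by positivity), p1, p1, p2, ← Real.rpow_mul (by norm_num), p3, hD,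
          Real.rpow_sub_one hY.ne']
        field_simp
      have h4 : D * (1 / 2) ^ (n + 1) * y (D * (1 - (1 / 2) ^ (n + 1)))
          ≤ D * (1 / 2) ^ (n + 1) * (Y * r ^ (n + 1)) :=
        step.trans ((mul_le_mul_of_nonneg_left h2 hN.le).trans_eq h3)
      exact le_of_mul_le_mul_left h4 (by positivity)
  have hlim : Tendsto (fun n : ℕ => Y * r ^ n) atTop (𝓝 0) := by
    simpa using (tendsto_pow_atTop_nhds_zero_of_lt_one hrpos.le hr1).const_mul Y
  refine le_antisymm (ge_of_tendsto' hlim fun n => le_trans (hanti ?_) (key n)) (hy _)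
  have : (0 : ℝ) < (1 / 2) ^ n := by positivity
  nlinarith

end Truncation

end EllipticDirichlet

/-! ### Sobolev inequalities and the energy inequality. -/

namespace EllipticDirichlet

open Filter
open scoped Topology

variable {d : ℕ} {Ω : Opens (Space d)}

/-- The critical Sobolev exponent `2d/(d-2)`. -/
noncomputable def sobolevExponent (d : ℕ) : ℝ≥0∞ := ENNReal.ofReal (2 * d / (d - 2))

theorem eLpNorm_gradient_test (φ : 𝓓(Ω, ℝ)) (p : ℝ≥0∞) :
    eLpNorm (fderiv ℝ φ) p volume = eLpNorm (gradient φ) p (vol Ω) := by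
  rw [eLpNorm_restrict_eq_of_support_subset]
  · exact eLpNorm_congr_norm_ae (Eventually.of_forall fun x => (norm_gradient φ x).symm)
  · intro x hx
    by_contra h
    exact hx (gradient_eq_zero_of_notMem_tsupport fun h' => h (φ.tsupport_subset h'))

/-- Gagliardo–Nirenberg–Sobolev on the whole space. Choosing the constant before `Ω` is what makes
the final constants independent of the domain's shape. -/
theorem exists_sobolev_const (hd : 3 ≤ d) : ∃ C : ℝ≥0, 0 < C ∧ ∀ (Ω : Opens (Space d))
    (φ : 𝓓(Ω, ℝ)), eLpNorm φ (sobolevExponent d) (vol Ω) ≤ C * eLpNorm (gradient φ) 2 (vol Ω) := by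
  have hd' : (3 : ℝ) ≤ d := by exact_mod_cast hd
  -- The `+ 1` only ensures positivity, which the final constants inherit.
  refine ⟨SNormLESNormFDerivOfEqConst ℝ (volume : Measure (Space d)) (2 : ℝ≥0) + 1, by positivity,
    fun Ω φ => ?_⟩
  have h := eLpNorm_le_eLpNorm_fderiv_of_eq (volume : Measure (Space d)) (u := φ)
    (p := 2) (p' := (2 * d / (d - 2) : ℝ).toNNReal) (φ.contDiff.of_le (by simp))
    φ.hasCompactSupport (by norm_num) (by rw [finrank_euclideanSpace_fin]; omega) (by
      have h2 : (d : ℝ) - 2 ≠ 0 := by linarith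
      have h0 : (d : ℝ) ≠ 0 := by linarith
      rw [finrank_euclideanSpace_fin, Real.coe_toNNReal _ (div_nonneg (by linarith) (by linarith))]
      push_cast
      field_simp)
  have e2 : eLpNorm (fderiv ℝ φ) ((2 : ℝ≥0) : ℝ≥0∞) volume = eLpNorm (gradient φ) 2 (vol Ω) :=
    eLpNorm_gradient_test φ 2
  rw [e2] at h
  refine (eLpNorm_mono_measure _ Measure.restrict_le_self).trans (h.trans ?_)
  gcongr
  exact le_self_add

/-- This constant depends on `Ω`. It serves only to obtain an `L²` limit from convergent gradients
and enters no estimate of the theorem. -/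
theorem exists_poincare_const (hd : 3 ≤ d) (hΩ : Bornology.IsBounded (Ω : Set (Space d))) :
    ∃ C : ℝ≥0, ∀ φ : 𝓓(Ω, ℝ), eLpNorm φ 2 (vol Ω) ≤ C * eLpNorm (gradient φ) 2 (vol Ω) := by
  refine ⟨eLpNormLESNormFDerivOfLeConst ℝ (volume : Measure (Space d)) (Ω : Set (Space d))
    (2 : ℝ≥0) (2 : ℝ≥0), fun φ => ?_⟩
  have h := eLpNorm_le_eLpNorm_fderiv (volume : Measure (Space d)) (u := φ)
    (p := 2) (φ.contDiff.of_le (by simp)) ((subset_tsupport _).trans φ.tsupport_subset)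
    (by norm_num) (by rw [finrank_euclideanSpace_fin]; exact_mod_cast (by omega)) hΩ
  have e2 : eLpNorm (fderiv ℝ φ) ((2 : ℝ≥0) : ℝ≥0∞) volume = eLpNorm (gradient φ) 2 (vol Ω) :=
    eLpNorm_gradient_test φ 2
  rw [e2] at h
  exact (eLpNorm_mono_measure _ Measure.restrict_le_self).trans h

theorem memLp_toEuclideanLin {A : Space d → Matrix (Fin d) (Fin d) ℝ} {M : ℝ}
    {G : Space d → Space d} (hA : ∀ i j, AEStronglyMeasurable (fun x => A x i j) (vol Ω))
    (hM : ∀ᵐ x ∂(vol Ω), ∀ i j, |A x i j| ≤ M) (hG : MemLp G 2 (vol Ω)) :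
    MemLp (fun x => (A x).toEuclideanLin (G x)) 2 (vol Ω) := by
  refine MemLp.of_eval_piLp fun i => ?_
  have e : (fun x => (A x).toEuclideanLin (G x) i) = fun x => ∑ j, A x i j • G x j := by
    ext x
    rfl
  rw [e]
  exact memLp_finsetSum _ fun j _ => memLp_smul_of_bounded (hA i j)
    (hM.mono fun x hx => hx i j) (memLp_coord hG j)

theorem tendsto_integral_mul_of_bounded {α : Type*} [MeasurableSpace α] {μ : Measure α}
    {h g : α → ℝ} {gn : ℕ → α → ℝ} {K : ℝ} (hh : Integrable h μ)
    (hgm : ∀ n, AEStronglyMeasurable (gn n) μ) (hK : ∀ n x, |gn n x| ≤ K)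
    (hg : ∀ᵐ x ∂μ, Tendsto (fun n => gn n x) atTop (𝓝 (g x))) :
    Tendsto (fun n => ∫ x, h x * gn n x ∂μ) atTop (𝓝 (∫ x, h x * g x ∂μ)) := by
  refine tendsto_integral_of_dominated_convergence (fun x => ‖h x‖ * K)
    (fun n => hh.1.mul (hgm n)) (hh.norm.mul_const K) ?_ ?_
  · refine fun n => Eventually.of_forall fun x => ?_
    rw [norm_mul]
    exact mul_le_mul_of_nonneg_left (hK n x) (norm_nonneg _)
  · filter_upwards [hg] with x hx
    exact hx.const_mul _

/-- Apply Sobolev to `S(φₙ)` for test functions `φₙ → u`, using Fatou on the left and `L²`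
convergence of `s(φₙ)∇φₙ` on the right. -/
theorem MemH120.eLpNorm_comp_le {u : Space d → ℝ} (hu : MemH120 Ω u) {C : ℝ≥0}
    (hC : ∀ φ : 𝓓(Ω, ℝ), eLpNorm φ (sobolevExponent d) (vol Ω) ≤ C * eLpNorm (gradient φ) 2 (vol Ω))
    {S s : ℝ → ℝ} {K : ℝ} (hS : ContDiff ℝ ((⊤ : ℕ∞) : WithTop ℕ∞) S) (hS0 : S 0 = 0)
    (hs : ∀ t, HasDerivAt S (s t) t) (hsc : Continuous s) (hK : ∀ t, |s t| ≤ K) :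
    eLpNorm (fun x => S (u x)) (sobolevExponent d) (vol Ω)
      ≤ C * eLpNorm (fun x => s (u x) • weakGradient Ω u x) 2 (vol Ω) := by
  obtain ⟨φ, -, h2, h3⟩ := hu.exists_seq
  have lim := tendsto_eLpNorm_sub_smul (K := K) (gn := fun n x => s (φ n x))
    (g := fun x => s (u x)) (fun n => (hsc.comp (φ n).continuous).aestronglyMeasurable)
    (fun n x => hK _) (h3.mono fun x hx => (hsc.tendsto _).comp hx) hu.memH12.memLp_grad
    (fun n => memLp_gradient_test (φ n) 2) h2
  have hsu : MemLp (fun x => s (u x) • weakGradient Ω u x) 2 (vol Ω) :=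
    memLp_smul_of_bounded (hsc.comp_aestronglyMeasurable hu.memH12.memLp.1)
      (Eventually.of_forall fun x => hK _) hu.memH12.memLp_grad
  have lim2 : Tendsto (fun n => (C : ℝ≥0∞) * (eLpNorm (fun x => s (φ n x) • gradient (φ n) x
      - s (u x) • weakGradient Ω u x) 2 (vol Ω)
      + eLpNorm (fun x => s (u x) • weakGradient Ω u x) 2 (vol Ω))) atTop
      (𝓝 (C * eLpNorm (fun x => s (u x) • weakGradient Ω u x) 2 (vol Ω))) := by
    have := ENNReal.Tendsto.const_mul (a := (C : ℝ≥0∞))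
      (lim.add_const (eLpNorm (fun x => s (u x) • weakGradient Ω u x) 2 (vol Ω)))
      (Or.inr ENNReal.coe_ne_top)
    simpa using this
  have fatou := Lp.eLpNorm_lim_le_liminf_eLpNorm (p := sobolevExponent d)
    (fun n => (compTest S hS hS0 (φ n)).continuous.aestronglyMeasurable (μ := vol Ω))
    (fun x => S (u x)) (h3.mono fun x hx => (hS.continuous.tendsto _).comp hx)
  refine fatou.trans ?_
  rw [← lim2.liminf_eq]
  refine liminf_le_liminf (Eventually.of_forall fun n => (hC _).trans ?_)
  gcongr
  have e : gradient (compTest S hS hS0 (φ n)) = (fun x => s (φ n x) • gradient (φ n) x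
      - s (u x) • weakGradient Ω u x) + fun x => s (u x) • weakGradient Ω u x := by
    ext1 x
    rw [gradient_compTest hS hS0 hs]
    simp
  rw [e]
  refine eLpNorm_add_le (AEStronglyMeasurable.sub ?_ hsu.1) hsu.1 (by norm_num)
  exact ((hsc.comp (φ n).continuous).smul (continuous_gradient (φ n))).aestronglyMeasurable

section Energy

variable {A : Space d → Matrix (Fin d) (Fin d) ℝ} {lam M : ℝ} {B : Space d → Space d}
  {c f u : Space d → ℝ}

/-- Test with `T(φₙ)` for `φₙ → u` and pass to the limit. Boundedness of `T` allows dominated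
convergence in the terms with `⟨B, ∇u⟩`, `c u` and `f`, which are merely integrable; the drift and
zeroth-order limits are nonnegative and are dropped. -/
theorem IsWeakSolution.energy_le (hA : UniformlyElliptic Ω A lam M) (hB : MemLp B 2 (vol Ω))
    (hdiv : WeakDivNonpos Ω B) (hc0 : ∀ᵐ x ∂(vol Ω), 0 ≤ c x) (hf : Integrable f (vol Ω))
    (hu : IsWeakSolution Ω A B c f u) {T τ : ℝ → ℝ} {K : ℝ}
    (hT : ContDiff ℝ ((⊤ : ℕ∞) : WithTop ℕ∞) T) (hT0 : T 0 = 0) (hτ : ∀ t, HasDerivAt T (τ t) t)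
    (hτc : Continuous τ) (hTK : ∀ t, |T t| ≤ K) (hτ0 : ∀ t, 0 ≤ τ t) (hτK : ∀ t, τ t ≤ K) :
    lam * ∫ x, τ (u x) * ‖weakGradient Ω u x‖ ^ 2 ∂(vol Ω) ≤ ∫ x, f x * T (u x) ∂(vol Ω) := by
  have hu0 := hu.memH120
  have hum := hu0.memH12.memLp.1
  have hg := hu0.memH12.memLp_grad
  obtain ⟨φ, -, h2, h3⟩ := hu0.exists_seq
  have hτK' : ∀ t, |τ t| ≤ K := fun t => by rw [abs_of_nonneg (hτ0 t)]; exact hτK t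
  have hTφ : ∀ n, AEStronglyMeasurable (fun x => T (φ n x)) (vol Ω) := fun n =>
    (hT.continuous.comp (φ n).continuous).aestronglyMeasurable
  have hτφ : ∀ n, AEStronglyMeasurable (fun x => τ (φ n x)) (vol Ω) := fun n =>
    (hτc.comp (φ n).continuous).aestronglyMeasurable
  have hTlim : ∀ᵐ x ∂(vol Ω), Tendsto (fun n => T (φ n x)) atTop (𝓝 (T (u x))) :=
    h3.mono fun x hx => (hT.continuous.tendsto _).comp hx
  have hτlim : ∀ᵐ x ∂(vol Ω), Tendsto (fun n => τ (φ n x)) atTop (𝓝 (τ (u x))) :=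
    h3.mono fun x hx => (hτc.tendsto _).comp hx
  have hTs : ∀ t, 0 ≤ t * T t := fun t => by
    have m : Monotone T := monotone_of_hasDerivAt_nonneg hτ hτ0
    rcases le_total 0 t with h | h
    · exact mul_nonneg h (hT0 ▸ m h)
    · exact mul_nonneg_of_nonpos_of_nonpos h (hT0 ▸ m h)
  have hX := memLp_toEuclideanLin hA.measurable hA.bounded hg
  have hτu : MemLp (fun x => τ (u x) • weakGradient Ω u x) 2 (vol Ω) :=
    memLp_smul_of_bounded (hτc.comp_aestronglyMeasurable hum)
      (Eventually.of_forall fun x => hτK' _) hg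
  have hTu : MemLp (fun x => T (u x) • weakGradient Ω u x) 2 (vol Ω) :=
    memLp_smul_of_bounded (hT.continuous.comp_aestronglyMeasurable hum)
      (Eventually.of_forall fun x => hTK _) hg
  have limA := tendsto_integral_inner hX hτu
    (fun n => memLp_smul_of_bounded (hτφ n) (Eventually.of_forall fun x => hτK' _)
      (memLp_gradient_test (φ n) 2))
    (tendsto_eLpNorm_sub_smul hτφ (fun n x => hτK' _) hτlim hg
      (fun n => memLp_gradient_test (φ n) 2) h2)
  have limB := tendsto_integral_mul_of_bounded (integrable_inner hB hg) hTφ (fun n x => hTK _) hTlim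
  have limC := tendsto_integral_mul_of_bounded hu.integrable_mul hTφ (fun n x => hTK _) hTlim
  have limF := tendsto_integral_mul_of_bounded hf hTφ (fun n x => hTK _) hTlim
  have limΦ := tendsto_integral_inner hB hTu
    (fun n => memLp_smul_of_bounded (hTφ n) (Eventually.of_forall fun x => hTK _)
      (memLp_gradient_test (φ n) 2))
    (tendsto_eLpNorm_sub_smul hTφ (fun n x => hTK _) hTlim hg
      (fun n => memLp_gradient_test (φ n) 2) h2)
  obtain ⟨Φ, hΦ, hΦ0, hΦd⟩ := exists_smooth_antideriv hT
  -- The divergence condition is applied to the nonnegative test functions `Φ(φₙ)`, whose gradients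
  -- `T(φₙ)∇φₙ` converge in `L²` to `T(u)∇u`.
  have hBpos : 0 ≤ ∫ x, inner ℝ (B x) (weakGradient Ω u x) * T (u x) ∂(vol Ω) := by
    have h := ge_of_tendsto' limΦ (fun n => by
      have := hdiv (compTest Φ hΦ hΦ0 (φ n)) fun x => antideriv_nonneg hΦd hΦ0 hTs _
      simpa only [gradient_compTest hΦ hΦ0 hΦd] using this)
    simpa only [real_inner_smul_right, mul_comm] using h
  have hCpos : 0 ≤ ∫ x, c x * u x * T (u x) ∂(vol Ω) := by
    refine integral_nonneg_of_ae (hc0.mono fun x hx => ?_)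
    change 0 ≤ c x * u x * T (u x)
    rw [mul_assoc]
    exact mul_nonneg hx (hTs _)
  have heq : ∫ x, inner ℝ ((A x).toEuclideanLin (weakGradient Ω u x))
        (τ (u x) • weakGradient Ω u x) ∂(vol Ω)
      + ∫ x, inner ℝ (B x) (weakGradient Ω u x) * T (u x) ∂(vol Ω)
      + ∫ x, c x * u x * T (u x) ∂(vol Ω) = ∫ x, f x * T (u x) ∂(vol Ω) := by
    refine tendsto_nhds_unique ((limA.add limB).add limC) (limF.congr fun n => ?_)
    have := hu.integral_eq (compTest T hT hT0 (φ n))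
    simpa only [gradient_compTest hT hT0 hτ, compTest_apply] using this.symm
  have hle : lam * ∫ x, τ (u x) * ‖weakGradient Ω u x‖ ^ 2 ∂(vol Ω)
      ≤ ∫ x, inner ℝ ((A x).toEuclideanLin (weakGradient Ω u x))
        (τ (u x) • weakGradient Ω u x) ∂(vol Ω) := by
    rw [← integral_const_mul]
    refine integral_mono_ae ?_ (integrable_inner hX hτu) ?_
    · refine ((integrable_inner hg hτu).const_mul lam).congr (Eventually.of_forall fun x => ?_)
      simp only [real_inner_smul_right, real_inner_self_eq_norm_sq]
    · filter_upwards [hA.elliptic] with x hx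
      simp only [real_inner_smul_right]
      have := mul_le_mul_of_nonneg_left (hx (weakGradient Ω u x)) (hτ0 (u x))
      linarith
  linarith

end Energy

end EllipticDirichlet

/-! ### Level set estimates, boundedness and uniqueness. -/

namespace EllipticDirichlet

open Filter
open scoped Topology

section Exponents

variable {d : ℕ} {p : ℝ}

theorem sobolevExponent_toReal (hd : 3 ≤ d) :
    (sobolevExponent d).toReal = 2 * d / (d - 2) := by
  have hd' : (3 : ℝ) ≤ d := by exact_mod_cast hd
  exact ENNReal.toReal_ofReal (div_nonneg (by linarith) (by linarith))

theorem holderConjugate_sobolevExponent (hd : 3 ≤ d) :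
    ENNReal.HolderConjugate (ENNReal.ofReal (2 * d / (d + 2))) (sobolevExponent d) := by
  have hd' : (3 : ℝ) ≤ d := by exact_mod_cast hd
  refine Real.HolderConjugate.ennrealOfReal (Real.holderConjugate_iff.2 ⟨?_, ?_⟩)
  · rw [lt_div_iff₀ (by linarith)]
    linarith
  · rw [inv_div, inv_div]
    field_simp
    ring

theorem dualExponent_le (hd : 3 ≤ d) (hp : (d : ℝ) < p) :
    ENNReal.ofReal (2 * d / (d + 2)) ≤ ENNReal.ofReal (p * d / (d + p)) := by
  have hd' : (3 : ℝ) ≤ d := by exact_mod_cast hd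
  apply ENNReal.ofReal_le_ofReal
  rw [div_le_div_iff₀ (by linarith) (by linarith)]
  nlinarith [mul_pos (show (0 : ℝ) < d by linarith) (show (0 : ℝ) < d by linarith)]

theorem dualExponent_sub (hd : 3 ≤ d) (hp : (d : ℝ) < p) :
    1 / (ENNReal.ofReal (2 * d / (d + 2))).toReal - 1 / (ENNReal.ofReal (p * d / (d + p))).toReal
      = 1 / 2 - 1 / p := by
  have hd' : (3 : ℝ) ≤ d := by exact_mod_cast hd
  have hp0 : 0 < p := by linarith
  rw [ENNReal.toReal_ofReal (by positivity), ENNReal.toReal_ofReal (by positivity)]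
  field_simp
  ring

/-- The quantity equals `(d - 2d/p)/(d - 2)`, which exceeds `1` exactly when `p > d`. -/
theorem one_lt_iteration_exponent (hd : 3 ≤ d) (hp : (d : ℝ) < p) :
    1 < (1 / 2 - 1 / p) * (2 * d / (d - 2)) := by
  have hd' : (3 : ℝ) ≤ d := by exact_mod_cast hd
  have hp0 : 0 < p := by linarith
  have h2 : (0 : ℝ) < d - 2 := by linarith
  have h3 : (d : ℝ) / p < 1 := (div_lt_one hp0).2 hp
  have e : (1 / 2 - 1 / p) * (2 * d / (d - 2)) = (d - 2 * (d / p)) / (d - 2) := by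
    field_simp
  rw [e, one_lt_div h2]
  linarith

end Exponents

section Hoelder

variable {α : Type*} [MeasurableSpace α] {μ : Measure α}

theorem lintegral_enorm_mul_le {f g : α → ℝ} (hf : AEStronglyMeasurable f μ)
    (hg : AEStronglyMeasurable g μ) (r s : ℝ≥0∞) [ENNReal.HolderConjugate r s] :
    ∫⁻ x, ‖f x * g x‖ₑ ∂μ ≤ eLpNorm f r μ * eLpNorm g s μ := by
  have h := eLpNorm_smul_le_mul_eLpNorm (p := r) (q := s) (r := 1) hg hf
  rwa [eLpNorm_one_eq_lintegral_enorm] at h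

/-- Only `E` contributes, and lowering the exponent of `f` from `q` to `r` there gains a power of `μ
E`. -/
theorem lintegral_enorm_mul_le_of_eq_zero {f g : α → ℝ} {E : Set α} {q r s : ℝ≥0∞}
    [ENNReal.HolderConjugate r s] (hrq : r ≤ q) (hE : NullMeasurableSet E μ)
    (hf : AEStronglyMeasurable f μ) (hg : AEStronglyMeasurable g μ) (h0 : ∀ x ∉ E, g x = 0) :
    ∫⁻ x, ‖f x * g x‖ₑ ∂μ
      ≤ eLpNorm f q μ * μ E ^ (1 / r.toReal - 1 / q.toReal) * eLpNorm g s μ := by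
  have e : ∫⁻ x, ‖f x * g x‖ₑ ∂μ = ∫⁻ x in E, ‖f x * g x‖ₑ ∂μ := by
    rw [← lintegral_indicator₀ hE]
    congr 1
    ext x
    by_cases hx : x ∈ E
    · rw [Set.indicator_of_mem hx]
    · rw [Set.indicator_of_notMem hx, h0 x hx]
      simp
  rw [e]
  refine (lintegral_enorm_mul_le hf.restrict hg.restrict r s).trans ?_
  gcongr
  · have h := eLpNorm_le_eLpNorm_mul_rpow_measure_univ hrq (hf.restrict (s := E))
    rw [Measure.restrict_apply_univ] at h
    refine h.trans ?_
    gcongr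
    exact Measure.restrict_le_self
  · exact Measure.restrict_le_self

end Hoelder

theorem eLpNorm_two_sq {α E : Type*} [MeasurableSpace α] {μ : Measure α} [NormedAddCommGroup E]
    [InnerProductSpace ℝ E] {G : α → E} (hG : MemLp G 2 μ) :
    eLpNorm G 2 μ ^ 2 = ENNReal.ofReal (∫ x, ‖G x‖ ^ 2 ∂μ) := by
  have h := inner_toLp_toLp hG hG
  simp only [real_inner_self_eq_norm_sq] at h
  rw [← h, Lp.norm_toLp, ENNReal.ofReal_pow ENNReal.toReal_nonneg,
    ENNReal.ofReal_toReal hG.eLpNorm_ne_top]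

section Level

variable {d : ℕ} {Ω : Opens (Space d)} {A : Space d → Matrix (Fin d) (Fin d) ℝ} {lam M : ℝ}
  {B : Space d → Space d} {c f u : Space d → ℝ}

/-- Energy inequality with `T' = s²`: its left side is then `λ‖s(u)∇u‖²`, to which Sobolev applies,
while `|T| ≤ L|S|` keeps only one factor `L` on the right. -/
theorem IsWeakSolution.eLpNorm_truncation_sq_le [IsFiniteMeasure (vol Ω)] {C : ℝ≥0}
    (hC : ∀ φ : 𝓓(Ω, ℝ), eLpNorm φ (sobolevExponent d) (vol Ω) ≤ C * eLpNorm (gradient φ) 2 (vol Ω))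
    (hlam : 0 < lam)
    (hA : UniformlyElliptic Ω A lam M) (hB : MemLp B 2 (vol Ω))
    (hdiv : WeakDivNonpos Ω B) (hc0 : ∀ᵐ x ∂(vol Ω), 0 ≤ c x) (hf : Integrable f (vol Ω))
    (hu : IsWeakSolution Ω A B c f u) {S s : ℝ → ℝ} {L : ℝ}
    (hS : ContDiff ℝ ((⊤ : ℕ∞) : WithTop ℕ∞) S) (hS0 : S 0 = 0) (hs : ∀ t, HasDerivAt S (s t) t)
    (hs0 : ∀ t, 0 ≤ s t) (hsL : ∀ t, s t ≤ L) (hS1 : ∀ t, |S t| ≤ 1) :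
    ENNReal.ofReal lam * eLpNorm (fun x => S (u x)) (sobolevExponent d) (vol Ω) ^ 2
      ≤ C ^ 2 * (ENNReal.ofReal L * ∫⁻ x, ‖f x * S (u x)‖ₑ ∂(vol Ω)) := by
  have hL : 0 ≤ L := (hs0 0).trans (hsL 0)
  have hss : ContDiff ℝ ((⊤ : ℕ∞) : WithTop ℕ∞) s := by
    have := (contDiff_infty_iff_deriv.1 hS).2
    rwa [show deriv S = s from funext fun t => (hs t).deriv] at this
  obtain ⟨T, hT, hT0, hTd⟩ := exists_smooth_antideriv (hss.pow 2)
  have hTS : ∀ t, |T t| ≤ L * |S t| := antideriv_abs_le hL hs hTd hS0 hT0 (fun t => sq_nonneg _)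
    fun t => by rw [sq]; exact mul_le_mul_of_nonneg_right (hsL t) (hs0 t)
  have hum := hu.memH120.memH12.memLp.1
  have hsa : ∀ t, |s t| ≤ L := fun t => by rw [abs_of_nonneg (hs0 t)]; exact hsL t
  have en := hu.energy_le (K := max L (L ^ 2)) hA hB hdiv hc0 hf hT hT0 hTd (hss.pow 2).continuous
    (fun t => ((hTS t).trans (mul_le_of_le_one_right hL (hS1 t))).trans (le_max_left _ _))
    (fun t => sq_nonneg _)
    (fun t => (pow_le_pow_left₀ (hs0 t) (hsL t) 2).trans (le_max_right _ _))
  have hsu : MemLp (fun x => s (u x) • weakGradient Ω u x) 2 (vol Ω) :=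
    memLp_smul_of_bounded (hss.continuous.comp_aestronglyMeasurable hum)
      (Eventually.of_forall fun x => hsa _) hu.memH120.memH12.memLp_grad
  have sob := hu.memH120.eLpNorm_comp_le hC hS hS0 hs hss.continuous hsa
  have e1 : eLpNorm (fun x => s (u x) • weakGradient Ω u x) 2 (vol Ω) ^ 2
      = ENNReal.ofReal (∫ x, s (u x) ^ 2 * ‖weakGradient Ω u x‖ ^ 2 ∂(vol Ω)) := by
    rw [eLpNorm_two_sq hsu]
    simp only [norm_smul, mul_pow, Real.norm_eq_abs, sq_abs]
  have e2 : ENNReal.ofReal (∫ x, f x * T (u x) ∂(vol Ω))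
      ≤ ENNReal.ofReal L * ∫⁻ x, ‖f x * S (u x)‖ₑ ∂(vol Ω) := by
    rw [← lintegral_const_mul' _ _ ENNReal.ofReal_ne_top]
    refine (ENNReal.ofReal_le_ofReal (le_abs_self _)).trans ?_
    rw [← Real.norm_eq_abs, ofReal_norm]
    refine (enorm_integral_le_lintegral_enorm _).trans (lintegral_mono fun x => ?_)
    rw [← ofReal_norm, ← ofReal_norm, ← ENNReal.ofReal_mul hL]
    apply ENNReal.ofReal_le_ofReal
    rw [norm_mul, norm_mul, mul_left_comm]
    exact mul_le_mul_of_nonneg_left (hTS _) (norm_nonneg _)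
  calc ENNReal.ofReal lam * eLpNorm (fun x => S (u x)) (sobolevExponent d) (vol Ω) ^ 2
      ≤ ENNReal.ofReal lam
        * (C * eLpNorm (fun x => s (u x) • weakGradient Ω u x) 2 (vol Ω)) ^ 2 := by gcongr
    _ = C ^ 2 * ENNReal.ofReal
        (lam * ∫ x, s (u x) ^ 2 * ‖weakGradient Ω u x‖ ^ 2 ∂(vol Ω)) := by
        rw [mul_pow, e1, ENNReal.ofReal_mul hlam.le]
        ring
    _ ≤ C ^ 2 * (ENNReal.ofReal L * ∫⁻ x, ‖f x * S (u x)‖ₑ ∂(vol Ω)) := by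
        gcongr
        exact (ENNReal.ofReal_le_ofReal en).trans e2

theorem IsWeakSolution.level_le [IsFiniteMeasure (vol Ω)] (hd : 3 ≤ d) {p : ℝ} (hp : (d : ℝ) < p)
    {C : ℝ≥0}
    (hC : ∀ φ : 𝓓(Ω, ℝ), eLpNorm φ (sobolevExponent d) (vol Ω) ≤ C * eLpNorm (gradient φ) 2 (vol Ω))
    (hlam : 0 < lam)
    (hA : UniformlyElliptic Ω A lam M) (hB : MemLp B 2 (vol Ω))
    (hdiv : WeakDivNonpos Ω B) (hc0 : ∀ᵐ x ∂(vol Ω), 0 ≤ c x) (hf : Integrable f (vol Ω))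
    (hfq : MemLp f (ENNReal.ofReal (p * d / (d + p))) (vol Ω))
    (hu : IsWeakSolution Ω A B c f u) {S s : ℝ → ℝ} {L k h : ℝ}
    (hS : ContDiff ℝ ((⊤ : ℕ∞) : WithTop ℕ∞) S) (hS0 : S 0 = 0) (hs : ∀ t, HasDerivAt S (s t) t)
    (hs0 : ∀ t, 0 ≤ s t) (hsL : ∀ t, s t ≤ L) (hS1 : ∀ t, |S t| ≤ 1)
    (hSk : ∀ t, |t| ≤ k → S t = 0) (hSh : ∀ t, h ≤ |t| → |S t| = 1) :
    lam * (vol Ω).real {x | h < |u x|} ^ (1 / (sobolevExponent d).toReal)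
      ≤ C ^ 2 * L * (eLpNorm f (ENNReal.ofReal (p * d / (d + p))) (vol Ω)).toReal
        * (vol Ω).real {x | k < |u x|} ^ (1 / 2 - 1 / p) := by
  have hd' : (3 : ℝ) ≤ d := by exact_mod_cast hd
  have hL : 0 ≤ L := (hs0 0).trans (hsL 0)
  have := holderConjugate_sobolevExponent hd
  have hum := hu.memH120.memH12.memLp.1
  have hsr := sobolevExponent_toReal hd
  have hspos : 0 < (sobolevExponent d).toReal := by
    rw [hsr]; exact div_pos (by linarith) (by linarith)
  have hs_ne : sobolevExponent d ≠ 0 := fun h => by simp [h] at hspos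
  have hs_top : sobolevExponent d ≠ ∞ := ENNReal.ofReal_ne_top
  have hSu : AEStronglyMeasurable (fun x => S (u x)) (vol Ω) :=
    hS.continuous.comp_aestronglyMeasurable hum
  have hSm : MemLp (fun x => S (u x)) (sobolevExponent d) (vol Ω) :=
    MemLp.of_bound hSu 1 (Eventually.of_forall fun x => hS1 _)
  have hE : NullMeasurableSet {x | k < |u x|} (vol Ω) :=
    nullMeasurableSet_lt aemeasurable_const hum.aemeasurable.norm
  have h1 := hu.eLpNorm_truncation_sq_le hC hlam hA hB hdiv hc0 hf hS hS0 hs hs0 hsL hS1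
  have h2 := lintegral_enorm_mul_le_of_eq_zero (dualExponent_le hd hp) hE hf.1 hSu
    (fun x hx => hSk _ (not_lt.1 hx)) (s := sobolevExponent d)
  rw [dualExponent_sub hd hp] at h2
  set a := eLpNorm (fun x => S (u x)) (sobolevExponent d) (vol Ω) with ha
  set F := eLpNorm f (ENNReal.ofReal (p * d / (d + p))) (vol Ω) with hF
  have h3 : ENNReal.ofReal lam * a ^ 2
      ≤ C ^ 2 * (ENNReal.ofReal L * (F * vol Ω {x | k < |u x|} ^ (1 / 2 - 1 / p : ℝ) * a)) := by
    refine h1.trans ?_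
    gcongr
  have hγ : 0 ≤ 1 / 2 - 1 / p := by
    have : 1 / p ≤ 1 / 2 := one_div_le_one_div_of_le (by norm_num) (by linarith)
    linarith
  have h4 : lam * a.toReal ^ 2 ≤ C ^ 2 * (L * (F.toReal
      * (vol Ω).real {x | k < |u x|} ^ (1 / 2 - 1 / p : ℝ) * a.toReal)) := by
    have hfin : C ^ 2 * (ENNReal.ofReal L * (F * vol Ω {x | k < |u x|} ^ (1 / 2 - 1 / p : ℝ) * a))
        ≠ ∞ := by
      have h5 : vol Ω {x | k < |u x|} ^ (1 / 2 - 1 / p : ℝ) ≠ ∞ :=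
        ENNReal.rpow_ne_top_of_nonneg hγ (measure_ne_top _ _)
      have h6 : F ≠ ∞ := hfq.eLpNorm_ne_top
      have h7 : a ≠ ∞ := hSm.eLpNorm_ne_top
      finiteness
    have := ENNReal.toReal_mono hfin h3
    simpa [ENNReal.toReal_mul, ENNReal.toReal_pow, ← ENNReal.toReal_rpow, Measure.real,
      ENNReal.toReal_ofReal hlam.le, ENNReal.toReal_ofReal hL] using this
  -- Chebyshev's inequality, since `|S(u)| = 1` on this set.
  have h5 : (vol Ω).real {x | h < |u x|} ^ (1 / (sobolevExponent d).toReal) ≤ a.toReal := by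
    have ch := mul_meas_ge_le_pow_eLpNorm' (vol Ω) hs_ne hs_top hSu 1
    have hsub : vol Ω {x | h < |u x|} ≤ vol Ω {x | 1 ≤ ‖S (u x)‖ₑ} := by
      refine measure_mono fun x hx => ?_
      change 1 ≤ ‖S (u x)‖ₑ
      rw [← ofReal_norm, Real.norm_eq_abs, hSh _ (le_of_lt hx), ENNReal.ofReal_one]
    rw [ENNReal.one_rpow, one_mul] at ch
    have h6 := ENNReal.rpow_le_rpow (hsub.trans ch) (one_div_nonneg.2 hspos.le)
    rw [← ENNReal.rpow_mul, mul_one_div_cancel hspos.ne', ENNReal.rpow_one] at h6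
    have h7 := ENNReal.toReal_mono hSm.eLpNorm_ne_top h6
    rwa [← ENNReal.toReal_rpow] at h7
  -- Cancel one power of the critical norm of `S(u)`, which is finite because `S(u)` is bounded and
  -- `Ω` has finite measure.
  have h6 : lam * a.toReal ≤ C ^ 2 * L * F.toReal
      * (vol Ω).real {x | k < |u x|} ^ (1 / 2 - 1 / p : ℝ) := by
    rcases (ENNReal.toReal_nonneg (a := a)).eq_or_lt with h0 | h0
    · rw [← h0, mul_zero]
      positivity
    · refine le_of_mul_le_mul_right (le_trans (le_of_eq ?_) (h4.trans_eq ?_)) h0 <;> ring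
  exact (mul_le_mul_of_nonneg_left h5 hlam.le).trans h6

end Level

/-- Boundedness of weak solutions. -/
theorem exists_bound_const {d : ℕ} (hd : 3 ≤ d) {lam : ℝ} (hlam : 0 < lam) {p : ℝ}
    (hp : (d : ℝ) < p) (m : ℝ≥0) : ∃ C₂ : ℝ, 0 < C₂ ∧
      ∀ Ω : Opens (Space d), volume (Ω : Set (Space d)) = m →
      ∀ (A : Space d → Matrix (Fin d) (Fin d) ℝ) (M : ℝ) (B : Space d → Space d)
        (c f u : Space d → ℝ),
      UniformlyElliptic Ω A lam M → MemLp B 2 (vol Ω) → WeakDivNonpos Ω B →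
      (∀ᵐ x ∂(vol Ω), 0 ≤ c x) → Integrable f (vol Ω) →
      MemLp f (ENNReal.ofReal (p * d / (d + p))) (vol Ω) → IsWeakSolution Ω A B c f u →
      eLpNorm u ∞ (vol Ω) ≤
        ENNReal.ofReal C₂ * eLpNorm f (ENNReal.ofReal (p * d / (d + p))) (vol Ω) := by
  obtain ⟨C, hC0, hC⟩ := exists_sobolev_const hd
  obtain ⟨L, hL0, hL⟩ := exists_truncation
  have hd' : (3 : ℝ) ≤ d := by exact_mod_cast hd
  have hsr := sobolevExponent_toReal hd
  have hspos : 0 < (sobolevExponent d).toReal := by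
    rw [hsr]; exact div_pos (by linarith) (by linarith)
  set β := (1 / 2 - 1 / p) * (sobolevExponent d).toReal with hβ
  have hβ1 : 1 < β := by rw [hβ, hsr]; exact one_lt_iteration_exponent hd hp
  -- Using `m + 1` keeps `Y` positive even when `Ω` is empty.
  set Y : ℝ := ((m : ℝ) + 1) ^ (1 / (sobolevExponent d).toReal) with hY
  have hYpos : 0 < Y := by positivity
  have hC0' : (0 : ℝ) < C := hC0
  set Q := C ^ 2 * L / lam with hQ
  have hQpos : 0 < Q := by positivity
  set R := Y ^ (β - 1) * 2 ^ (β / (β - 1)) with hR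
  have hRpos : 0 < R := by positivity
  refine ⟨Q * R, by positivity, ?_⟩
  intro Ω hm A M B c f u hA hB hdiv hc0 hf hfq hu
  have hfin : IsFiniteMeasure (vol Ω) := ⟨by rw [Measure.restrict_apply_univ, hm]; simp⟩
  set F := eLpNorm f (ENNReal.ofReal (p * d / (d + p))) (vol Ω) with hF
  have hFtop : F ≠ ∞ := hfq.eLpNorm_ne_top
  -- The iteration lemma needs a positive constant, but the norm of `f` may vanish; `ε` is sent to
  -- `0` at the end.
  have key : ∀ ε : ℝ, 0 < ε → eLpNorm u ∞ (vol Ω) ≤ ENNReal.ofReal (Q * (F.toReal + ε) * R) := by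
    intro ε hε
    have hN : 0 < Q * (F.toReal + ε) := mul_pos hQpos (by positivity)
    have it := eq_zero_of_iteration
      (y := fun k => (vol Ω).real {x | k < |u x|} ^ (1 / (sobolevExponent d).toReal))
      hβ1 hN hYpos (fun k => by positivity) ?_ ?_ ?_
    · have h0 : (vol Ω) {x | Q * (F.toReal + ε) * R < |u x|} = 0 := by
        have := (Real.rpow_eq_zero measureReal_nonneg (one_div_pos.2 hspos).ne').1 it
        rwa [measureReal_eq_zero_iff] at this
      have hae : ∀ᵐ x ∂(vol Ω), ‖u x‖ ≤ Q * (F.toReal + ε) * R := by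
        rw [ae_iff]
        simpa only [not_le, Real.norm_eq_abs] using h0
      rw [eLpNorm_exponent_top]
      exact eLpNormEssSup_le_of_ae_bound hae
    · intro k h hkh
      refine Real.rpow_le_rpow measureReal_nonneg ?_ (one_div_pos.2 hspos).le
      exact measureReal_mono fun x hx => lt_of_le_of_lt hkh hx
    · refine Real.rpow_le_rpow measureReal_nonneg ?_ (one_div_pos.2 hspos).le
      refine (measureReal_mono (Set.subset_univ _)).trans ?_
      rw [Measure.real, Measure.restrict_apply_univ, hm]
      simp
    · intro k h hk hkh
      obtain ⟨S, s, hS, hs, hs0, hsL, hSk, hS1, hSh⟩ := hL k h hk hkh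
      have lev := hu.level_le hd hp (hC Ω) hlam hA hB hdiv hc0 hf hfq hS
        (hSk 0 (by simpa using hk)) hs hs0 hsL hS1 hSk hSh
      have hhk : 0 < h - k := sub_pos.2 hkh
      have e : ((vol Ω).real {x | k < |u x|} ^ (1 / (sobolevExponent d).toReal)) ^ β
          = (vol Ω).real {x | k < |u x|} ^ (1 / 2 - 1 / p : ℝ) := by
        rw [← Real.rpow_mul measureReal_nonneg, hβ]
        congr 1
        field_simp
      beta_reduce
      rw [e]
      set z := (vol Ω).real {x | k < |u x|} ^ (1 / 2 - 1 / p : ℝ) with hz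
      set w := (vol Ω).real {x | h < |u x|} ^ (1 / (sobolevExponent d).toReal) with hw
      have hz0 : 0 ≤ z := by positivity
      have h1 : (h - k) * w ≤ Q * F.toReal * z := by
        rw [hQ]
        have h2 : C ^ 2 * (L / (h - k)) * F.toReal * z
            = (C ^ 2 * L * F.toReal * z) / (h - k) := by ring
        rw [h2, le_div_iff₀ hhk] at lev
        have h3 : C ^ 2 * L / lam * F.toReal * z = (C ^ 2 * L * F.toReal * z) / lam := by ring
        rw [h3, le_div_iff₀ hlam]
        linarith
      refine h1.trans (mul_le_mul_of_nonneg_right ?_ hz0)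
      exact mul_le_mul_of_nonneg_left (by linarith) hQpos.le
  have hlim : Tendsto (fun ε : ℝ => ENNReal.ofReal (Q * (F.toReal + ε) * R)) (𝓝[>] 0)
      (𝓝 (ENNReal.ofReal (Q * (F.toReal + 0) * R))) := by
    refine ((ENNReal.continuous_ofReal.comp ?_).tendsto 0).mono_left nhdsWithin_le_nhds
    fun_prop
  have h := ge_of_tendsto hlim (by filter_upwards [self_mem_nhdsWithin] with ε hε using key ε hε)
  rw [add_zero, show Q * F.toReal * R = Q * R * F.toReal by ring,
    ENNReal.ofReal_mul (by positivity), ENNReal.ofReal_toReal hFtop] at h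
  exact h

theorem uniqueness {d : ℕ} (hd : 3 ≤ d) {lam : ℝ} (hlam : 0 < lam) {Ω : Opens (Space d)}
    (hΩ : Bornology.IsBounded (Ω : Set (Space d))) {A : Space d → Matrix (Fin d) (Fin d) ℝ} {M : ℝ}
    {B : Space d → Space d} {c v : Space d → ℝ} (hA : UniformlyElliptic Ω A lam M)
    (hB : MemLp B 2 (vol Ω)) (hdiv : WeakDivNonpos Ω B) (hc0 : ∀ᵐ x ∂(vol Ω), 0 ≤ c x)
    (hv : IsWeakSolution Ω A B c 0 v) : v =ᵐ[vol Ω] 0 := by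
  -- With zero right-hand side any exponent above `d` works; `d + 1` is taken.
  obtain ⟨C, -, h⟩ := exists_bound_const hd hlam (lt_add_one (d : ℝ))
    (volume (Ω : Set (Space d))).toNNReal
  have h1 := h Ω (ENNReal.coe_toNNReal hΩ.measure_lt_top.ne).symm A M B c 0 v hA hB hdiv hc0
    (integrable_zero _ _ _) MemLp.zero hv
  rw [eLpNorm_zero, mul_zero, nonpos_iff_eq_zero] at h1
  exact (eLpNorm_eq_zero_iff hv.memH120.memH12.memLp.1 (by simp)).1 h1

/-! ### Linearity of the equation. -/

section Difference

variable {d : ℕ} {Ω : Opens (Space d)} {A : Space d → Matrix (Fin d) (Fin d) ℝ} {lam M : ℝ}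
  {B : Space d → Space d} {c f u w : Space d → ℝ}

theorem integrable_mul_test {g : Space d → ℝ} (hg : Integrable g (vol Ω)) (φ : 𝓓(Ω, ℝ)) :
    Integrable (fun x => g x * φ x) (vol Ω) := by
  obtain ⟨K, hK⟩ := φ.continuous.bounded_above_of_compact_support φ.hasCompactSupport
  exact hg.mul_bdd φ.continuous.aestronglyMeasurable (Eventually.of_forall hK)

theorem IsWeakSolution.sub (hA : UniformlyElliptic Ω A lam M) (hB : MemLp B 2 (vol Ω))
    (hw : IsWeakSolution Ω A B c f w) (hu : IsWeakSolution Ω A B c f u) :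
    IsWeakSolution Ω A B c 0 (fun x => w x - u x) where
  memH120 := hw.memH120.sub hu.memH120
  integrable_mul := by
    simpa only [mul_sub] using! hw.integrable_mul.sub hu.integrable_mul
  integral_eq φ := by
    have hae := hw.memH120.weakGradient_sub_ae hu.memH120
    have gw := hw.memH120.memH12.memLp_grad
    have gu := hu.memH120.memH12.memLp_grad
    have hφ := memLp_gradient_test φ 2
    have e1 : ∫ x, inner ℝ ((A x).toEuclideanLin (weakGradient Ω (fun x => w x - u x) x))
          (gradient φ x) ∂(vol Ω)
        = ∫ x, inner ℝ ((A x).toEuclideanLin (weakGradient Ω w x)) (gradient φ x) ∂(vol Ω)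
          - ∫ x, inner ℝ ((A x).toEuclideanLin (weakGradient Ω u x)) (gradient φ x) ∂(vol Ω) := by
      rw [← integral_sub (integrable_inner (memLp_toEuclideanLin hA.measurable hA.bounded gw) hφ)
        (integrable_inner (memLp_toEuclideanLin hA.measurable hA.bounded gu) hφ)]
      refine integral_congr_ae (hae.mono fun x hx => ?_)
      simp only [hx, map_sub, inner_sub_left]
    have e2 : ∫ x, inner ℝ (B x) (weakGradient Ω (fun x => w x - u x) x) * φ x ∂(vol Ω)
        = ∫ x, inner ℝ (B x) (weakGradient Ω w x) * φ x ∂(vol Ω)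
          - ∫ x, inner ℝ (B x) (weakGradient Ω u x) * φ x ∂(vol Ω) := by
      rw [← integral_sub (integrable_mul_test (integrable_inner hB gw) φ)
        (integrable_mul_test (integrable_inner hB gu) φ)]
      refine integral_congr_ae (hae.mono fun x hx => ?_)
      simp only [hx, inner_sub_right, sub_mul]
    have e3 : ∫ x, c x * (w x - u x) * φ x ∂(vol Ω)
        = ∫ x, c x * w x * φ x ∂(vol Ω) - ∫ x, c x * u x * φ x ∂(vol Ω) := by
      rw [← integral_sub (integrable_mul_test hw.integrable_mul φ)
        (integrable_mul_test hu.integrable_mul φ)]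
      refine integral_congr_ae (Eventually.of_forall fun x => ?_)
      ring
    have h1 := hw.integral_eq φ
    have h2 := hu.integral_eq φ
    rw [e1, e2, e3]
    simp only [Pi.zero_apply, zero_mul, integral_zero]
    linarith

end Difference

end EllipticDirichlet

/-! ### Existence by Lions' theorem. -/

namespace EllipticDirichlet

open Filter
open scoped Topology

/-- Lions' variant of the Lax–Milgram theorem. -/
theorem exists_inner_eq_of_coercive {V H : Type*} [AddCommGroup V] [Module ℝ V]
    [NormedAddCommGroup H] [InnerProductSpace ℝ H] [CompleteSpace H] (ι K : V →ₗ[ℝ] H)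
    (l : V →ₗ[ℝ] ℝ) {C : ℝ} (hC : 0 ≤ C) (hcoer : ∀ φ, ‖ι φ‖ ^ 2 ≤ inner ℝ (ι φ) (K φ))
    (hl : ∀ φ, |l φ| ≤ C * ‖ι φ‖) :
    ∃ h ∈ closure (Set.range ι), ‖h‖ ≤ C ∧ ∀ φ, inner ℝ h (K φ) = l φ := by
  set W := (LinearMap.range ι).topologicalClosure with hW
  have : CompleteSpace W := (Submodule.isClosed_topologicalClosure _).completeSpace_coe
  have hιW : ∀ φ, ι φ ∈ W := fun φ => Submodule.le_topologicalClosure _ ⟨φ, rfl⟩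
  -- Projecting `K` to the closure `W` of the range of `ι` leaves the pairings with `W` unchanged
  -- and places the representing vector in `W`. Coercivity becomes `‖ι φ‖ ≤ ‖N φ‖`, so `l` is
  -- bounded relative to `N` although `K` need not be bounded relative to `ι`.
  let N : V →ₗ[ℝ] W := (W.orthogonalProjectionOnto : H →ₗ[ℝ] W) ∘ₗ K
  have hN : ∀ (w : W) φ, inner ℝ (w : H) (K φ) = inner ℝ w (N φ) := fun w φ =>
    (Submodule.inner_orthogonalProjectionOnto_eq_of_mem_left w (K φ)).symm
  have hιN : ∀ φ, ‖ι φ‖ ≤ ‖N φ‖ := fun φ => by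
    have h1 := (hcoer φ).trans_eq (hN ⟨ι φ, hιW φ⟩ φ)
    have h2 := h1.trans (real_inner_le_norm _ _)
    rcases (norm_nonneg (ι φ)).eq_or_lt with h0 | h0
    · rw [← h0]; positivity
    · refine le_of_mul_le_mul_left ?_ h0
      rw [← sq]
      exact h2
  have hlN : ∀ φ, |l φ| ≤ C * ‖N φ‖ := fun φ =>
    (hl φ).trans (mul_le_mul_of_nonneg_left (hιN φ) hC)
  obtain ⟨g, hg⟩ := N.rangeRestrict.exists_rightInverse_of_surjective N.range_rangeRestrict
  have hg' : ∀ y, N (g y) = y := fun y => congrArg Subtype.val (LinearMap.congr_fun hg y)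
  let F : StrongDual ℝ (LinearMap.range N) := (l ∘ₗ g).mkContinuous C fun y => by
    have := hlN (g y)
    rwa [hg'] at this
  obtain ⟨F', hF', hFn⟩ := exists_extension_norm_eq _ F
  have hFle : ‖F'‖ ≤ C := hFn ▸ LinearMap.mkContinuous_norm_le _ hC _
  refine ⟨((InnerProductSpace.toDual ℝ W).symm F' : W), ?_, ?_, fun φ => ?_⟩
  · exact ((InnerProductSpace.toDual ℝ W).symm F').2
  · refine le_trans (le_of_eq ?_) hFle
    exact (InnerProductSpace.toDual ℝ W).symm.norm_map F'
  · rw [hN, InnerProductSpace.toDual_symm_apply]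
    have h1 := hF' ⟨N φ, ⟨φ, rfl⟩⟩
    refine h1.trans ?_
    change l (g ⟨N φ, ⟨φ, rfl⟩⟩) = l φ
    -- The value does not depend on the preimage: `l` vanishes on the kernel of `N` by the bound
    -- `hlN`.
    have h2 : N (g ⟨N φ, ⟨φ, rfl⟩⟩ - φ) = 0 := by rw [map_sub, hg', sub_self]
    have h3 := hlN (g ⟨N φ, ⟨φ, rfl⟩⟩ - φ)
    rw [h2, norm_zero, mul_zero, map_sub] at h3
    exact sub_eq_zero.1 (abs_nonpos_iff.1 h3)

/-- The linear map into `L²` induced by a linear family of square integrable functions. -/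
noncomputable def toLpLinear {V α E : Type*} [AddCommGroup V] [Module ℝ V] [MeasurableSpace α]
    {μ : Measure α} [NormedAddCommGroup E] [InnerProductSpace ℝ E] (F : V → α → E)
    (hF : ∀ φ, MemLp (F φ) 2 μ) (hadd : ∀ φ ψ x, F (φ + ψ) x = F φ x + F ψ x)
    (hsmul : ∀ (a : ℝ) φ x, F (a • φ) x = a • F φ x) : V →ₗ[ℝ] Lp E 2 μ where
  toFun φ := (hF φ).toLp (F φ)
  map_add' φ ψ := by
    rw [← MemLp.toLp_add]
    exact MemLp.toLp_congr _ _ (Eventually.of_forall fun x => hadd φ ψ x)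
  map_smul' a φ := by
    rw [RingHom.id_apply, ← MemLp.toLp_const_smul]
    exact MemLp.toLp_congr _ _ (Eventually.of_forall fun x => hsmul a φ x)

theorem inner_toEuclideanLin_conjTranspose {d : ℕ} (A : Matrix (Fin d) (Fin d) ℝ)
    (x y : Space d) :
    inner ℝ x (A.conjTranspose.toEuclideanLin y) = inner ℝ (A.toEuclideanLin x) y := by
  rw [Matrix.toEuclideanLin_conjTranspose_eq_adjoint, LinearMap.adjoint_inner_right]

variable {d : ℕ} {Ω : Opens (Space d)}

theorem memLp_test_smul {E : Type*} [NormedAddCommGroup E] [InnerProductSpace ℝ E]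
    {X : Space d → E} (hX : MemLp X 2 (vol Ω)) (φ : 𝓓(Ω, ℝ)) :
    MemLp (fun x => φ x • X x) 2 (vol Ω) := by
  obtain ⟨K, hK⟩ := φ.continuous.bounded_above_of_compact_support φ.hasCompactSupport
  exact memLp_smul_of_bounded φ.continuous.aestronglyMeasurable (Eventually.of_forall hK) hX

/-- A sequence of test functions whose gradients converge in `L²` and whose products with a fixed
weight converge in `L²` has a limit in `H^{1,2}_0`. -/
theorem exists_memH120_of_tendsto {C : ℝ≥0}
    (hC : ∀ φ : 𝓓(Ω, ℝ), eLpNorm φ 2 (vol Ω) ≤ C * eLpNorm (gradient φ) 2 (vol Ω))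
    {ρ w : Space d → ℝ} {G : Space d → Space d} {φ : ℕ → 𝓓(Ω, ℝ)}
    (hρ : MemLp ρ 2 (vol Ω)) (hw : MemLp w 2 (vol Ω)) (hG : MemLp G 2 (vol Ω))
    (h1 : Tendsto (fun n => eLpNorm (fun x => gradient (φ n) x - G x) 2 (vol Ω)) atTop (𝓝 0))
    (h2 : Tendsto (fun n => eLpNorm (fun x => φ n x • ρ x - w x) 2 (vol Ω)) atTop (𝓝 0)) :
    ∃ u, MemH120 Ω u ∧ weakGradient Ω u =ᵐ[vol Ω] G ∧ w =ᵐ[vol Ω] fun x => u x * ρ x := by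
  let f0 : ℕ → Lp ℝ 2 (vol Ω) := fun n => (memLp_test (φ n) 2).toLp (φ n)
  let f1 : ℕ → Lp (Space d) 2 (vol Ω) := fun n =>
    (memLp_gradient_test (φ n) 2).toLp (gradient (φ n))
  have hf1 : CauchySeq f1 :=
    ((Lp.tendsto_Lp_iff_tendsto_eLpNorm'' _ (fun n => memLp_gradient_test (φ n) 2) G hG).2
      h1).cauchySeq
  have hdist : ∀ m n, dist (f0 m) (f0 n) ≤ C * dist (f1 m) (f1 n) := by
    intro m n
    rw [dist_eq_norm, dist_eq_norm, ← MemLp.toLp_sub, ← MemLp.toLp_sub, Lp.norm_toLp, Lp.norm_toLp]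
    have h := hC (φ m - φ n)
    have e : gradient (φ m - φ n : 𝓓(Ω, ℝ)) = gradient (φ m) - gradient (φ n) := by
      ext1 x
      exact gradient_sub_test _ _ x
    rw [e, FunLike.coe_sub] at h
    have hfin : (C : ℝ≥0∞) * eLpNorm (gradient (φ m) - gradient (φ n)) 2 (vol Ω) ≠ ∞ :=
      ENNReal.mul_ne_top ENNReal.coe_ne_top
        ((memLp_gradient_test (φ m) 2).sub (memLp_gradient_test (φ n) 2)).eLpNorm_ne_top
    have := ENNReal.toReal_mono hfin h
    rwa [ENNReal.toReal_mul, ENNReal.coe_toReal] at this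
  have hf0 : CauchySeq f0 := by
    rw [Metric.cauchySeq_iff] at hf1 ⊢
    intro ε hε
    have hC1 : (0 : ℝ) < C + 1 := by positivity
    obtain ⟨n₀, hn₀⟩ := hf1 (ε / (C + 1)) (by positivity)
    refine ⟨n₀, fun m hm n hn => (hdist m n).trans_lt ?_⟩
    have h3 := hn₀ m hm n hn
    rw [lt_div_iff₀ hC1] at h3
    nlinarith [dist_nonneg (x := f1 m) (y := f1 n)]
  obtain ⟨U, hU⟩ := cauchySeq_tendsto_of_complete hf0
  have hUm : MemLp U 2 (vol Ω) := Lp.memLp U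
  have h0 : Tendsto (fun n => eLpNorm (fun x => φ n x - U x) 2 (vol Ω)) atTop (𝓝 0) := by
    refine (Lp.tendsto_Lp_iff_tendsto_eLpNorm'' _ (fun n => memLp_test (φ n) 2) U hUm).1 ?_
    rwa [Lp.toLp_coeFn]
  refine ⟨U, memH120_of_tendsto hUm hG h0 h1, ?_, ?_⟩
  · have hwg := hasWeakGradient_of_tendsto hUm hG h0 h1
    exact (weakGradient_spec hwg).ae_eq hwg
  · have tm : TendstoInMeasure (vol Ω) (fun n => (φ n : Space d → ℝ)) atTop U :=
      tendstoInMeasure_of_tendsto_eLpNorm (by norm_num) (fun n => (memLp_test (φ n) 2).1) hUm.1 h0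
    obtain ⟨ns, hns, hae⟩ := tm.exists_seq_tendsto_ae
    have tm2 : TendstoInMeasure (vol Ω) (fun n => fun x => φ (ns n) x • ρ x) atTop w :=
      tendstoInMeasure_of_tendsto_eLpNorm (by norm_num)
        (fun n => (memLp_test_smul hρ (φ (ns n))).1) hw.1 (h2.comp hns.tendsto_atTop)
    obtain ⟨ms, hms, hae2⟩ := tm2.exists_seq_tendsto_ae
    filter_upwards [hae, hae2] with x hx hx2
    exact tendsto_nhds_unique hx2 ((hx.comp hms.tendsto_atTop).mul_const (ρ x))

section Existence

variable {A : Space d → Matrix (Fin d) (Fin d) ℝ} {lam M : ℝ} {B : Space d → Space d}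
  {c f : Space d → ℝ}

/-- In `L² × L²` take `ι φ = (∇φ, φρ)` and `K φ = (λ⁻¹(Aᵀ∇φ + φB), φρ)` with `ρ = √(c/λ)`. Pairing
`(∇u, uρ)` with `K φ` is `λ⁻¹` times the weak form. Sobolev and duality bound the right-hand side by
`C/λ` times the norm of `f`, which is the gradient constant. -/
theorem exists_solution (hd : 3 ≤ d) (hlam : 0 < lam)
    (hΩ : Bornology.IsBounded (Ω : Set (Space d))) {C : ℝ≥0}
    (hC : ∀ φ : 𝓓(Ω, ℝ), eLpNorm φ (sobolevExponent d) (vol Ω) ≤ C * eLpNorm (gradient φ) 2 (vol Ω))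
    (hA : UniformlyElliptic Ω A lam M) (hB : MemLp B 2 (vol Ω)) (hdiv : WeakDivNonpos Ω B)
    (hc : Integrable c (vol Ω)) (hc0 : ∀ᵐ x ∂(vol Ω), 0 ≤ c x) (hf : Integrable f (vol Ω))
    (hfr : MemLp f (ENNReal.ofReal (2 * d / (d + 2))) (vol Ω)) :
    ∃ u, IsWeakSolution Ω A B c f u ∧ eLpNorm (weakGradient Ω u) 2 (vol Ω)
      ≤ ENNReal.ofReal (C / lam) * eLpNorm f (ENNReal.ofReal (2 * d / (d + 2))) (vol Ω) := by
  obtain ⟨CP, hCP⟩ := exists_poincare_const hd hΩ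
  have := holderConjugate_sobolevExponent hd
  set F := eLpNorm f (ENNReal.ofReal (2 * d / (d + 2))) (vol Ω) with hF
  have hFtop : F ≠ ∞ := hfr.eLpNorm_ne_top
  let ρ : Space d → ℝ := fun x => √(c x / lam)
  have hρsq : ∀ᵐ x ∂(vol Ω), ρ x * ρ x = c x / lam := hc0.mono fun x hx =>
    Real.mul_self_sqrt (div_nonneg hx hlam.le)
  have hρ : MemLp ρ 2 (vol Ω) := by
    have hm : AEStronglyMeasurable ρ (vol Ω) :=
      Real.continuous_sqrt.comp_aestronglyMeasurable (hc.div_const lam).1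
    rw [memLp_two_iff_integrable_sq hm]
    refine (hc.div_const lam).congr (hρsq.mono fun x hx => ?_)
    change c x / lam = ρ x ^ 2
    rw [sq, hx]
  let f1 : 𝓓(Ω, ℝ) →ₗ[ℝ] Lp (Space d) 2 (vol Ω) := toLpLinear (fun φ => gradient φ)
    (fun φ => memLp_gradient_test φ 2) gradient_add_test gradient_smul_test
  let f2 : 𝓓(Ω, ℝ) →ₗ[ℝ] Lp ℝ 2 (vol Ω) := toLpLinear (fun φ x => φ x • ρ x)
    (fun φ => memLp_test_smul hρ φ) (fun φ ψ x => add_smul (φ x) (ψ x) (ρ x))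
    (fun a φ x => mul_smul a (φ x) (ρ x))
  have hAt : ∀ φ : 𝓓(Ω, ℝ),
      MemLp (fun x => (A x).conjTranspose.toEuclideanLin (gradient φ x)) 2 (vol Ω) := fun φ =>
    memLp_toEuclideanLin (fun i j => hA.measurable j i) (M := M)
      (hA.bounded.mono fun x hx i j => hx j i) (memLp_gradient_test φ 2)
  let k : 𝓓(Ω, ℝ) → Space d → Space d := fun φ x =>
    lam⁻¹ • ((A x).conjTranspose.toEuclideanLin (gradient φ x) + φ x • B x)
  have hk : ∀ φ, MemLp (k φ) 2 (vol Ω) := fun φ =>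
    ((hAt φ).add (memLp_test_smul hB φ)).const_smul lam⁻¹
  let k1 : 𝓓(Ω, ℝ) →ₗ[ℝ] Lp (Space d) 2 (vol Ω) := toLpLinear k hk
    (fun φ ψ x => by
      change lam⁻¹ • ((A x).conjTranspose.toEuclideanLin (gradient (φ + ψ : 𝓓(Ω, ℝ)) x)
        + (φ x + ψ x) • B x) = _
      rw [gradient_add_test, map_add, add_smul, ← smul_add, add_add_add_comm])
    (fun a φ x => by
      change lam⁻¹ • ((A x).conjTranspose.toEuclideanLin (gradient (a • φ : 𝓓(Ω, ℝ)) x)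
        + (a * φ x) • B x) = _
      rw [gradient_smul_test, map_smul, mul_smul, ← smul_add, smul_comm])
  let e := (WithLp.linearEquiv 2 ℝ (Lp (Space d) 2 (vol Ω) × Lp ℝ 2 (vol Ω))).symm
  let ι : 𝓓(Ω, ℝ) →ₗ[ℝ] WithLp 2 (Lp (Space d) 2 (vol Ω) × Lp ℝ 2 (vol Ω)) :=
    e.toLinearMap ∘ₗ f1.prod f2
  let K : 𝓓(Ω, ℝ) →ₗ[ℝ] WithLp 2 (Lp (Space d) 2 (vol Ω) × Lp ℝ 2 (vol Ω)) :=
    e.toLinearMap ∘ₗ k1.prod f2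
  let l : 𝓓(Ω, ℝ) →ₗ[ℝ] ℝ :=
    { toFun := fun φ => lam⁻¹ * ∫ x, f x * φ x ∂(vol Ω)
      map_add' := fun φ ψ => by
        simp only [FunLike.coe_add, Pi.add_apply, mul_add]
        rw [integral_add (integrable_mul_test hf φ) (integrable_mul_test hf ψ), mul_add]
      map_smul' := fun a φ => by
        simp only [FunLike.coe_smul, Pi.smul_apply, smul_eq_mul, RingHom.id_apply]
        rw [← integral_const_mul, ← integral_const_mul, ← integral_const_mul]
        congr 1
        ext x
        ring }
  have hkG : ∀ (G : Space d → Space d) (_ : MemLp G 2 (vol Ω)) (φ : 𝓓(Ω, ℝ)),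
      ∫ x, inner ℝ (G x) (k φ x) ∂(vol Ω)
        = lam⁻¹ * (∫ x, inner ℝ ((A x).toEuclideanLin (G x)) (gradient φ x) ∂(vol Ω)
          + ∫ x, inner ℝ (B x) (G x) * φ x ∂(vol Ω)) := by
    intro G hG φ
    rw [← integral_add (integrable_inner (memLp_toEuclideanLin hA.measurable hA.bounded hG)
      (memLp_gradient_test φ 2)) (integrable_mul_test (integrable_inner hB hG) φ),
      ← integral_const_mul]
    congr 1
    ext x
    simp only [k, real_inner_smul_right, inner_add_right, inner_toEuclideanLin_conjTranspose]
    rw [real_inner_comm (B x) (G x)]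
    ring
  have hcoer : ∀ φ, ‖ι φ‖ ^ 2 ≤ inner ℝ (ι φ) (K φ) := by
    intro φ
    have e1 : ‖ι φ‖ ^ 2 = inner ℝ (f1 φ) (f1 φ) + inner ℝ (f2 φ) (f2 φ) := by
      rw [← real_inner_self_eq_norm_sq]
      rfl
    have e2 : inner ℝ (ι φ) (K φ) = inner ℝ (f1 φ) (k1 φ) + inner ℝ (f2 φ) (f2 φ) := rfl
    rw [e1, e2]
    refine add_le_add ?_ le_rfl
    have g := memLp_gradient_test φ 2
    have e3 : inner ℝ (f1 φ) (f1 φ) = ∫ x, inner ℝ (gradient φ x) (gradient φ x) ∂(vol Ω) :=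
      inner_toLp_toLp g g
    have e4 : inner ℝ (f1 φ) (k1 φ) = ∫ x, inner ℝ (gradient φ x) (k φ x) ∂(vol Ω) :=
      inner_toLp_toLp g (hk φ)
    rw [e3, e4, hkG _ g]
    -- Here `φ∇φ = ∇(φ²/2)`, and `φ²/2` is a nonnegative test function.
    have hpos : 0 ≤ ∫ x, inner ℝ (B x) (gradient φ x) * φ x ∂(vol Ω) := by
      have := hdiv (compTest (fun t => t ^ 2 / 2) (by fun_prop) (by norm_num) φ)
        fun x => by rw [compTest_apply]; positivity
      have hd2 : ∀ t : ℝ, HasDerivAt (fun t : ℝ => t ^ 2 / 2) t t := fun t => by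
        simpa using ((hasDerivAt_id t).pow 2).div_const 2
      simp only [gradient_compTest _ _ hd2, real_inner_smul_right] at this
      simpa only [mul_comm] using this
    have hell : lam * ∫ x, inner ℝ (gradient φ x) (gradient φ x) ∂(vol Ω)
        ≤ ∫ x, inner ℝ ((A x).toEuclideanLin (gradient φ x)) (gradient φ x) ∂(vol Ω) := by
      rw [← integral_const_mul]
      refine integral_mono_ae ((integrable_inner g g).const_mul _)
        (integrable_inner (memLp_toEuclideanLin hA.measurable hA.bounded g) g) ?_
      filter_upwards [hA.elliptic] with x hx
      rw [real_inner_self_eq_norm_sq]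
      exact hx _
    rw [← div_eq_inv_mul, le_div_iff₀ hlam]
    linarith
  have hnorm1 : ∀ h : WithLp 2 (Lp (Space d) 2 (vol Ω) × Lp ℝ 2 (vol Ω)), ‖h.fst‖ ≤ ‖h‖ := by
    intro h
    have := WithLp.prod_norm_sq_eq_of_L2 h
    exact le_of_sq_le_sq (by nlinarith [sq_nonneg ‖h.snd‖]) (norm_nonneg _)
  have hl : ∀ φ, |l φ| ≤ (C / lam * F.toReal) * ‖ι φ‖ := by
    intro φ
    have h1 : ‖∫ x, f x * φ x ∂(vol Ω)‖ₑ ≤ F * (C * eLpNorm (gradient φ) 2 (vol Ω)) := by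
      refine (enorm_integral_le_lintegral_enorm _).trans ?_
      refine (lintegral_enorm_mul_le hf.1 φ.continuous.aestronglyMeasurable
        (ENNReal.ofReal (2 * d / (d + 2)))
        (sobolevExponent d)).trans ?_
      gcongr
      exact hC φ
    have hfin : F * (C * eLpNorm (gradient φ) 2 (vol Ω)) ≠ ∞ :=
      ENNReal.mul_ne_top hFtop (ENNReal.mul_ne_top ENNReal.coe_ne_top
        (memLp_gradient_test φ 2).eLpNorm_ne_top)
    have h2 := ENNReal.toReal_mono hfin h1
    rw [toReal_enorm, Real.norm_eq_abs, ENNReal.toReal_mul, ENNReal.toReal_mul,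
      ENNReal.coe_toReal] at h2
    have h3 : (eLpNorm (gradient φ) 2 (vol Ω)).toReal ≤ ‖ι φ‖ := by
      rw [← Lp.norm_toLp _ (memLp_gradient_test φ 2)]
      exact hnorm1 (ι φ)
    have e1 : |l φ| = lam⁻¹ * |∫ x, f x * φ x ∂(vol Ω)| := by
      change |lam⁻¹ * ∫ x, f x * φ x ∂(vol Ω)| = _
      rw [abs_mul, abs_of_pos (inv_pos.2 hlam)]
    rw [e1]
    calc lam⁻¹ * |∫ x, f x * φ x ∂(vol Ω)| ≤ lam⁻¹ * (F.toReal * (C * ‖ι φ‖)) := by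
          gcongr
          exact h2.trans (by gcongr)
      _ = _ := by ring
  obtain ⟨h, hcl, hle, heq⟩ := exists_inner_eq_of_coercive ι K l (by positivity) hcoer hl
  obtain ⟨y, hy, hylim⟩ := mem_closure_iff_seq_limit.1 hcl
  choose φ hφ using hy
  have hG : MemLp h.fst 2 (vol Ω) := Lp.memLp h.fst
  have hw : MemLp h.snd 2 (vol Ω) := Lp.memLp h.snd
  have t1 : Tendsto (fun n => f1 (φ n)) atTop (𝓝 h.fst) := by
    have := ((WithLp.prod_continuous_ofLp 2 _ _).fst.tendsto h).comp hylim
    refine this.congr fun n => ?_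
    rw [Function.comp_apply, ← hφ n]
    rfl
  have t2 : Tendsto (fun n => f2 (φ n)) atTop (𝓝 h.snd) := by
    have := ((WithLp.prod_continuous_ofLp 2 _ _).snd.tendsto h).comp hylim
    refine this.congr fun n => ?_
    rw [Function.comp_apply, ← hφ n]
    rfl
  obtain ⟨u, hu, hgrad, hwu⟩ := exists_memH120_of_tendsto hCP hρ hw hG
    ((Lp.tendsto_Lp_iff_tendsto_eLpNorm'' _ (fun n => memLp_gradient_test (φ n) 2) _ hG).1
      (by rw [Lp.toLp_coeFn]; exact t1))
    ((Lp.tendsto_Lp_iff_tendsto_eLpNorm'' _ (fun n => memLp_test_smul hρ (φ n)) _ hw).1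
      (by rw [Lp.toLp_coeFn]; exact t2))
  -- The second component of `h` is `uρ`, so `c u` is a product of two `L²` functions, hence
  -- integrable.
  have hcu : ∀ᵐ x ∂(vol Ω), lam * (ρ x * h.snd x) = c x * u x := by
    filter_upwards [hwu, hρsq] with x hx hx2
    rw [hx, mul_comm (u x), ← mul_assoc (ρ x), hx2]
    field_simp
  refine ⟨u, ⟨hu, ?_, fun ψ => ?_⟩, ?_⟩
  · refine ((integrable_inner hρ hw).const_mul lam).congr (hcu.mono fun x hx => ?_)
    beta_reduce
    rw [← hx, RCLike.inner_apply, conj_trivial, mul_comm (ρ x)]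
  · have e1 : inner ℝ h (K ψ) = inner ℝ h.fst (k1 ψ) + inner ℝ h.snd (f2 ψ) := rfl
    have e2 : inner ℝ h.fst (k1 ψ) = ∫ x, inner ℝ (h.fst x) (k ψ x) ∂(vol Ω) := by
      rw [← inner_toLp_toLp hG (hk ψ), Lp.toLp_coeFn]
      rfl
    have e3 : inner ℝ h.snd (f2 ψ) = lam⁻¹ * ∫ x, c x * u x * ψ x ∂(vol Ω) := by
      have e4 : inner ℝ h.snd (f2 ψ) = ∫ x, inner ℝ (h.snd x) (ψ x • ρ x) ∂(vol Ω) := by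
        rw [← inner_toLp_toLp hw (memLp_test_smul hρ ψ), Lp.toLp_coeFn]
        rfl
      rw [e4, ← integral_const_mul]
      refine integral_congr_ae (hcu.mono fun x hx => ?_)
      simp only [← hx, RCLike.inner_apply, conj_trivial, smul_eq_mul]
      field_simp
    have e5 : l ψ = lam⁻¹ * ∫ x, f x * ψ x ∂(vol Ω) := rfl
    have main := heq ψ
    rw [e1, e2, e3, hkG _ hG, e5, ← mul_add] at main
    have main' := mul_left_cancel₀ (inv_ne_zero hlam.ne') main
    rw [← main']
    congr 2
    · exact integral_congr_ae (hgrad.mono fun x hx => by simp only [hx])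
    · exact integral_congr_ae (hgrad.mono fun x hx => by simp only [hx])
  · rw [eLpNorm_congr_ae hgrad, ← ENNReal.ofReal_toReal hG.eLpNorm_ne_top,
      ← ENNReal.ofReal_toReal hFtop, ← ENNReal.ofReal_mul (by positivity)]
    exact ENNReal.ofReal_le_ofReal ((hnorm1 h).trans hle)

end Existence

end EllipticDirichlet

/-! ### Assembly of uniqueness, existence and the two bounds. -/

theorem mainTheorem6 (d : ℕ) (hd : 3 ≤ d) (lam : ℝ) (hlam : 0 < lam) :
    -- (i) uniqueness
    (∀ Ω : Opens (Space d), Bornology.IsBounded (Ω : Set (Space d)) →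
      ∀ (A : Space d → Matrix (Fin d) (Fin d) ℝ) (M : ℝ)
        (B : Space d → Space d)
        (c : Space d → ℝ),
      UniformlyElliptic Ω A lam M →
      MemLp B 2 (vol Ω) →
      WeakDivNonpos Ω B →
      Integrable c (vol Ω) →
      (∀ᵐ x ∂(vol Ω), 0 ≤ c x) →
      ∀ v : Space d → ℝ,
        MemH120 Ω v →
        Integrable (fun x => c x * v x) (vol Ω) →
        (∀ φ : 𝓓(Ω, ℝ),
          ∫ x, inner ℝ ((A x).toEuclideanLin (weakGradient Ω v x))
              (gradient φ x) ∂(vol Ω)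
            + ∫ x, inner ℝ (B x) (weakGradient Ω v x) * φ x
              ∂(vol Ω)
            + ∫ x, c x * v x * φ x ∂(vol Ω) = 0) →
        v =ᵐ[vol Ω] 0) ∧
    -- (ii) existence, with constants `C₁ = C₁(d, lam)` and `C₂ = C₂(d, lam, p, |Ω|)`
    (∃ C₁ : ℝ, 0 < C₁ ∧ ∀ p : ℝ, (d : ℝ) < p → ∀ m : ℝ≥0, ∃ C₂ : ℝ, 0 < C₂ ∧
      ∀ Ω : Opens (Space d), Bornology.IsBounded (Ω : Set (Space d)) →
        volume (Ω : Set (Space d)) = m →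
      ∀ (A : Space d → Matrix (Fin d) (Fin d) ℝ) (M : ℝ)
        (B : Space d → Space d)
        (c f : Space d → ℝ),
      UniformlyElliptic Ω A lam M →
      MemLp B 2 (vol Ω) →
      WeakDivNonpos Ω B →
      Integrable c (vol Ω) →
      (∀ᵐ x ∂(vol Ω), 0 ≤ c x) →
      MemLp f (ENNReal.ofReal (p * d / (d + p))) (vol Ω) →
      ∃ u : Space d → ℝ,
        IsWeakSolution Ω A B c f u ∧
        MemLp u ∞ (vol Ω) ∧
        eLpNorm (weakGradient Ω u) 2 (vol Ω) ≤
          ENNReal.ofReal C₁ *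
            eLpNorm f (ENNReal.ofReal (2 * d / (d + 2))) (vol Ω) ∧
        eLpNorm u ∞ (vol Ω) ≤
          ENNReal.ofReal C₂ *
            eLpNorm f (ENNReal.ofReal (p * d / (d + p))) (vol Ω) ∧
        ∀ w : Space d → ℝ, IsWeakSolution Ω A B c f w →
          w =ᵐ[vol Ω] u) := by
  obtain ⟨C, hC0, hC⟩ := exists_sobolev_const hd
  have hC0' : (0 : ℝ) < C := hC0
  refine ⟨?_, C / lam, by positivity, fun p hp m => ?_⟩
  · intro Ω hΩ A M B c hA hB hdiv _ hc0 v hv hcv heq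
    exact uniqueness hd hlam hΩ hA hB hdiv hc0 ⟨hv, hcv, fun φ => by simpa using heq φ⟩
  · obtain ⟨C₂, hC₂, hbound⟩ := exists_bound_const hd hlam hp m
    refine ⟨C₂, hC₂, ?_⟩
    intro Ω hΩ hm A M B c f hA hB hdiv hc hc0 hfq
    have : IsFiniteMeasure (vol Ω) := ⟨by rw [Measure.restrict_apply_univ, hm]; simp⟩
    have hfr : MemLp f (ENNReal.ofReal (2 * d / (d + 2))) (vol Ω) :=
      hfq.mono_exponent (dualExponent_le hd hp)
    have hf : Integrable f (vol Ω) := hfr.integrable (by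
      have := holderConjugate_sobolevExponent hd
      exact ENNReal.HolderConjugate.one_le _ (sobolevExponent d))
    obtain ⟨u, hu, hgrad⟩ := exists_solution hd hlam hΩ (hC Ω) hA hB hdiv hc hc0 hf hfr
    have hb := hbound Ω hm A M B c f u hA hB hdiv hc0 hf hfq hu
    refine ⟨u, hu, ⟨hu.memH120.memH12.memLp.1, hb.trans_lt ?_⟩, hgrad, hb, fun w hw => ?_⟩
    · exact ENNReal.mul_lt_top ENNReal.ofReal_lt_top hfq.eLpNorm_lt_top
    · filter_upwards [uniqueness hd hlam hΩ hA hB hdiv hc0 (hw.sub hA hB hu)] with x hx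
      exact sub_eq_zero.1 hx
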